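/- Let $n\ge 1$, $t\ge 0$, and let $A_0,\dots,A_t\in\{0,1\}^{n\times n}$ be random symmetric matrices with zero diagonal, defined on a common probability space, whose entries $a^{(k)}_{ij}$ ($0\le k\le t$, $1\le i<j\le n$) are independent with $a^{(k)}_{ij}\sim\mathrm{Ber}(p^{(k)}_{ij})$. Let $\alpha_n>0$ be such that $p^{(k)}_{ij}\le\alpha_n$ for all $k$ and all $i\ne j$. Let $\beta_0,\dots,\beta_t\ge 0$ and $\beta_{\max},C_\beta>0$ satisfy $$\sum_{k=0}^t\beta_k=1,\qquad \beta_k\le\beta_{\max}\ \text{ for all } k,\qquad \sum_{k=0}^t\beta_k^2\le C_\beta\,\beta_{\max}.$$ Put $A=\sum_{k=0}^t\beta_kA_{t-k}$ and $P=\mathbb E(A)=(p_{ij})$, and assume that there are $\bar n_{\max}\ge\bar n_{\min}>0$ with $\alpha_n\bar n_{\min}\le\sum_jp_{ij}\le\alpha_n\bar n_{\max}$ for all $i$. Let $\mu_B=\bar n_{\max}/\bar n_{\min}$. For a symmetric matrix $M$ with nonnegative entries and positive row sums $d_i(M)=\sum_jM_{ij}$, let $L(M)=D(M)^{-1/2}MD(M)^{-1/2}$,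 where $D(M)=\mathrm{diag}(d_1(M),\dots,d_n(M))$; let $\|\cdot\|$ be the spectral norm. Then there is a universal constant $C>0$ (independent of $n$, $t$, the probability space and all the parameters above) such that for all $c>0$ $$\mathbb P\Big(\|L(A)-L(P)\|\ge\frac{C(1+c)\mu_B}{\bar n_{\min}}\sqrt{\frac{n\beta_{\max}}{\alpha_n}}\Big)\le e^{-\left(\frac{c^2/2}{2C_\beta+\frac23c}-\log 14\right)n}+e^{-\frac{c^2/2}{C_\beta+2c/3}\cdot\frac{n\alpha_n}{\beta_{\max}}+\log n}+e^{-\frac{1/8}{C_\beta+1/3}\cdot\frac{\bar n_{\min}\alpha_n}{\mu_B\beta_{\max}}+\log n}+n^{-\frac c4+6},$$ where the event on the left is understood to include the event that some row sum of $A$ is $0$ (so that $L(A)$ is undefined). -/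

import Mathlib

open MeasureTheory ProbabilityTheory

noncomputable section

/-- The random matrices `a 0, …, a t` (on a common probability space) are symmetric `0`-`1` matrices
with zero diagonal, whose entries above the diagonal, taken over all times, are mutually independent,
the entry `(i, j)` of `a k` being Bernoulli with parameter `p k i j` for `i ≠ j`. -/
structure IsSymmBernoulli {Ω : Type*} [MeasurableSpace Ω] (μ : Measure Ω) {n t : ℕ}
    (a : Fin (t + 1) → Ω → Matrix (Fin n) (Fin n) ℝ)
    (p : Fin (t + 1) → Fin n → Fin n → ℝ) : Prop where
  zero_or_one : ∀ k ω i j, a k ω i j = 0 ∨ a k ω i j = 1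
  measurable : ∀ k i j, Measurable fun ω => a k ω i j
  symmetric : ∀ k ω i j, a k ω j i = a k ω i j
  diag_zero : ∀ k ω i, a k ω i i = 0
  prob_one : ∀ k i j, i ≠ j → μ.real {ω | a k ω i j = 1} = p k i j
  indep : iIndepFun
    (fun (e : {e : Fin (t + 1) × Fin n × Fin n // e.2.1 < e.2.2}) (ω : Ω) =>
      a e.1.1 ω e.1.2.1 e.1.2.2) μ

/-- The smoothed adjacency matrix `∑_{k = 0}^t β_k A_{t - k}` (`Fin.rev k` is `t - k`). -/
def smoothedMatrix {Ω : Type*} {n t : ℕ} (β : Fin (t + 1) → ℝ)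
    (a : Fin (t + 1) → Ω → Matrix (Fin n) (Fin n) ℝ) (ω : Ω) : Matrix (Fin n) (Fin n) ℝ :=
  ∑ k, β k • a k.rev ω

/-- The entrywise expectation of a random matrix. -/
def expectedMatrix {Ω : Type*} [MeasurableSpace Ω] (μ : Measure Ω) {n : ℕ}
    (A : Ω → Matrix (Fin n) (Fin n) ℝ) : Matrix (Fin n) (Fin n) ℝ :=
  Matrix.of fun i j => ∫ ω, A ω i j ∂μ

/-- The degree `d_i = ∑_j M_{ij}`. -/
def rowDegree {n : ℕ} (M : Matrix (Fin n) (Fin n) ℝ) (i : Fin n) : ℝ := ∑ j, M i j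

/-- The normalized Laplacian `D(M)^{-1/2} M D(M)^{-1/2}`, with `D(M)` the diagonal matrix of degrees
(meaningful when all degrees are positive). -/
def normalizedLaplacian {n : ℕ} (M : Matrix (Fin n) (Fin n) ℝ) : Matrix (Fin n) (Fin n) ℝ :=
  Matrix.diagonal (fun i => (√(rowDegree M i))⁻¹) * M *
    Matrix.diagonal (fun i => (√(rowDegree M i))⁻¹)

/-- The spectral norm of a matrix: its operator norm for the Euclidean norm. -/
def matrixSpectralNorm {n : ℕ} (M : Matrix (Fin n) (Fin n) ℝ) : ℝ :=
  ‖Matrix.toEuclideanCLM (n := Fin n) (𝕜 := ℝ) M‖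

end

/-! Write `b` for the maximal weight, `X = A / b` and `m = P / b`. Each entry of `X` is a sum of
independent Bernoulli variables with coefficients in `[0, 1]`, so by convexity of the exponential
its moment generating function is at most that of a Poisson variable with the same mean. This
domination (`IsSymmBernoulli.poissonDominated`) is all the probability that is used: Chernoff and
Bernstein bounds for linear statistics of `X` follow from it, as if `X` were the adjacency matrix of
one sparse random graph with mean degrees at most `q² = nα/b`.

The norm of `X - m` is then bounded by the method of Friedman, Kahn and Szemerédi. On a grid of
vectors, the pairs with `|x_i y_j| ≤ q/n` are handled by Bernstein and a union bound. The heavy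
pairs are handled deterministically from bounded degrees and bounded discrepancy (`sum_heavy_le`),
and discrepancy is bounded with high probability by a union bound over pairs of sets. The outcome,
in `PoissonDominated.concentration`, is `‖X - m‖ ≲ κq`, together with a Euclidean bound of order
`κ√(nM)` for the vector of degree deviations, where `M` bounds the expected degrees.

For the Laplacian, let `S = diag √(d(P)/d(A))`. Then `L(A) - L(P)` equals `D(A)^{-1/2} (A - P)
D(A)^{-1/2}` plus `S L(P) S - L(P)`. The first term is governed by the spectral norm. The second is
governed by the Frobenius norm of `(S - 1) L(P)`, hence by the Euclidean norm of the degree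
deviations, which avoids requiring every degree to be close to its mean: it is enough that no degree
falls below `1/16` of it.

Of the four terms in the probability bound, the third absorbs the lower tail of the degrees and the
fourth everything else. In the regimes where one of the terms is at least `1` there is nothing to
prove, and outside them `log n` is at most the least expected degree of `X`. -/

/-! ### Exponential moments: comparison with Poisson variables. -/

section PoissonDomination

variable {Ω : Type*} [MeasurableSpace Ω] {μ : Measure Ω} {n : ℕ}

/-- The linear statistics of the random matrix `X` have exponential moments dominated by those of
a symmetric matrix of Poisson variables with means `p`. -/
def PoissonDominated (μ : Measure Ω) (X : Ω → Matrix (Fin n) (Fin n) ℝ)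
    (p : Matrix (Fin n) (Fin n) ℝ) : Prop :=
  ∀ w : Fin n → Fin n → ℝ,
    Integrable (fun ω => Real.exp (∑ i, ∑ j, w i j * X ω i j)) μ ∧
    ∫ ω, Real.exp (∑ i, ∑ j, w i j * X ω i j) ∂μ ≤
      Real.exp (1 / 2 * ∑ i, ∑ j, p i j * (Real.exp (2 * w i j) - 1))

lemma sum_sum_eq_sum_lt {n : ℕ} (f : Fin n → Fin n → ℝ) (hf : ∀ i, f i i = 0) :
    ∑ i, ∑ j, f i j = ∑ i, ∑ j, if i < j then f i j + f j i else 0 := by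
  have h : ∀ i j, f i j = (if i < j then f i j else 0) + (if j < i then f i j else 0) := by
    intro i j
    rcases lt_trichotomy i j with h | h | h
    · simp [h, h.le]
    · subst h; simp [hf]
    · simp [h, h.le]
  have h2 : ∑ i, ∑ j, f i j
      = ∑ i, ∑ j, (if i < j then f i j else 0) + ∑ i, ∑ j, (if j < i then f i j else 0) := by
    rw [← Finset.sum_add_distrib]
    refine Finset.sum_congr rfl fun i _ => ?_
    rw [← Finset.sum_add_distrib]
    exact Finset.sum_congr rfl fun j _ => h i j
  rw [h2, Finset.sum_comm (f := fun i j => if j < i then f i j else 0), ← Finset.sum_add_distrib]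
  refine Finset.sum_congr rfl fun i _ => ?_
  rw [← Finset.sum_add_distrib]
  refine Finset.sum_congr rfl fun j _ => ?_
  split_ifs <;> simp

lemma sum_subtype_lt {n t : ℕ} (f : Fin (t + 1) → Fin n → Fin n → ℝ) :
    ∑ e : {e : Fin (t + 1) × Fin n × Fin n // e.2.1 < e.2.2}, f e.1.1 e.1.2.1 e.1.2.2 =
      ∑ i, ∑ j, if i < j then ∑ k, f k i j else 0 := by
  rw [← Finset.sum_subtype (Finset.univ.filter
    fun e : Fin (t + 1) × Fin n × Fin n => e.2.1 < e.2.2) (by simp)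
    (fun e => f e.1 e.2.1 e.2.2), Finset.sum_filter, Fintype.sum_prod_type_right,
    Fintype.sum_prod_type]
  refine Finset.sum_congr rfl fun i _ => Finset.sum_congr rfl fun j _ => ?_
  split_ifs <;> simp

lemma smoothedMatrix_apply {Ω : Type*} {n t : ℕ} (β : Fin (t + 1) → ℝ)
    (a : Fin (t + 1) → Ω → Matrix (Fin n) (Fin n) ℝ) (ω : Ω) (i j : Fin n) :
    smoothedMatrix β a ω i j = ∑ k, β k.rev * a k ω i j := by
  simp only [smoothedMatrix, Matrix.sum_apply, Matrix.smul_apply, smul_eq_mul]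
  exact Fintype.sum_equiv Fin.revPerm _ _ (fun k => by simp)

/-- Convexity of `exp` between `0` and `w`. This is where normalizing by the largest weight pays: a
scaled Bernoulli variable is dominated by a Poisson variable of the same mean. -/
lemma exp_mul_sub_one_le {θ w : ℝ} (h0 : 0 ≤ θ) (h1 : θ ≤ 1) :
    Real.exp (θ * w) - 1 ≤ θ * (Real.exp w - 1) := by
  have := convexOn_exp.2 (Set.mem_univ w) (Set.mem_univ 0) h0 (sub_nonneg.2 h1) (by ring)
  simp only [smul_eq_mul, mul_zero, add_zero, Real.exp_zero, mul_one] at this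
  linarith

lemma exp_add_le_half (x y : ℝ) :
    Real.exp (x + y) ≤ 1 / 2 * Real.exp (2 * x) + 1 / 2 * Real.exp (2 * y) := by
  have h := sq_nonneg (Real.exp x - Real.exp y)
  have hx : Real.exp (2 * x) = Real.exp x ^ 2 := by rw [← Real.exp_nat_mul]; norm_num
  have hy : Real.exp (2 * y) = Real.exp y ^ 2 := by rw [← Real.exp_nat_mul]; norm_num
  rw [hx, hy, Real.exp_add]
  nlinarith

lemma mgf_le_of_zero_or_one [IsProbabilityMeasure μ] {f : Ω → ℝ} (hf : ∀ ω, f ω = 0 ∨ f ω = 1)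
    (hm : Measurable f) (c : ℝ) :
    mgf f μ c ≤ Real.exp (μ.real {ω | f ω = 1} * (Real.exp c - 1)) := by
  have h : ∀ ω, Real.exp (c * f ω)
      = 1 + (Real.exp c - 1) * Set.indicator {ω | f ω = 1} (fun _ => (1 : ℝ)) ω := by
    intro ω
    rcases hf ω with h | h <;> simp [h, Set.indicator]
  have hs : MeasurableSet {ω | f ω = 1} := hm (measurableSet_singleton 1)
  rw [mgf, integral_congr_ae (Filter.Eventually.of_forall h), integral_add (integrable_const _)
    (((integrable_const (1 : ℝ)).indicator hs).const_mul _), integral_const_mul,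
    integral_indicator_const _ hs]
  simp only [integral_const, probReal_univ, smul_eq_mul, mul_one]
  linarith [Real.add_one_le_exp (μ.real {ω | f ω = 1} * (Real.exp c - 1))]

variable {t : ℕ} {a : Fin (t + 1) → Ω → Matrix (Fin n) (Fin n) ℝ}
  {p : Fin (t + 1) → Fin n → Fin n → ℝ}

lemma IsSymmBernoulli.integral_apply [IsProbabilityMeasure μ] (h : IsSymmBernoulli μ a p)
    {i j : Fin n} (hij : i ≠ j) (k : Fin (t + 1)) : ∫ ω, a k ω i j ∂μ = p k i j := by
  have hs : MeasurableSet {ω | a k ω i j = 1} := h.measurable k i j (measurableSet_singleton 1)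
  have e : ∀ ω, a k ω i j = Set.indicator {ω | a k ω i j = 1} (fun _ => (1 : ℝ)) ω := by
    intro ω
    rcases h.zero_or_one k ω i j with h | h <;> simp [h, Set.indicator]
  rw [integral_congr_ae (Filter.Eventually.of_forall e), integral_indicator_const _ hs]
  simp [h.prob_one k i j hij]

lemma IsSymmBernoulli.integrable_apply [IsProbabilityMeasure μ] (h : IsSymmBernoulli μ a p)
    (i j : Fin n) (k : Fin (t + 1)) : Integrable (fun ω => a k ω i j) μ := by
  refine Integrable.of_bound (h.measurable k i j).aestronglyMeasurable 1
    (Filter.Eventually.of_forall fun ω => ?_)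
  rcases h.zero_or_one k ω i j with h | h <;> simp [h]

lemma IsSymmBernoulli.expectedMatrix_apply [IsProbabilityMeasure μ] (h : IsSymmBernoulli μ a p)
    (β : Fin (t + 1) → ℝ) {i j : Fin n} (hij : i ≠ j) :
    expectedMatrix μ (smoothedMatrix β a) i j = ∑ k, β k.rev * p k i j := by
  simp only [expectedMatrix, Matrix.of_apply, smoothedMatrix_apply]
  rw [integral_finsetSum _ fun k _ => (h.integrable_apply i j k).const_mul _]
  simp_rw [integral_const_mul, h.integral_apply hij]

lemma IsSymmBernoulli.expectedMatrix_diag (h : IsSymmBernoulli μ a p)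
    (β : Fin (t + 1) → ℝ) (i : Fin n) :
    expectedMatrix μ (smoothedMatrix β a) i i = 0 := by
  simp [expectedMatrix, Matrix.of_apply, smoothedMatrix_apply, h.diag_zero]

lemma IsSymmBernoulli.smoothedMatrix_symm (h : IsSymmBernoulli μ a p)
    (β : Fin (t + 1) → ℝ) (ω : Ω) (i j : Fin n) :
    smoothedMatrix β a ω j i = smoothedMatrix β a ω i j := by
  simp [smoothedMatrix_apply, h.symmetric _ ω i j]

lemma IsSymmBernoulli.expectedMatrix_symm (h : IsSymmBernoulli μ a p)
    (β : Fin (t + 1) → ℝ) (i j : Fin n) :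
    expectedMatrix μ (smoothedMatrix β a) j i = expectedMatrix μ (smoothedMatrix β a) i j := by
  simp [expectedMatrix, Matrix.of_apply, h.smoothedMatrix_symm β _ i j]

lemma IsSymmBernoulli.smoothedMatrix_nonneg (h : IsSymmBernoulli μ a p)
    {β : Fin (t + 1) → ℝ} (hβ : ∀ k, 0 ≤ β k) (ω : Ω) (i j : Fin n) :
    0 ≤ smoothedMatrix β a ω i j := by
  rw [smoothedMatrix_apply]
  refine Finset.sum_nonneg fun k _ => mul_nonneg (hβ _) ?_
  rcases h.zero_or_one k ω i j with h | h <;> simp [h]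

lemma IsSymmBernoulli.expectedMatrix_nonneg (h : IsSymmBernoulli μ a p)
    {β : Fin (t + 1) → ℝ} (hβ : ∀ k, 0 ≤ β k) (i j : Fin n) :
    0 ≤ expectedMatrix μ (smoothedMatrix β a) i j := by
  rw [expectedMatrix, Matrix.of_apply]
  exact integral_nonneg fun ω => h.smoothedMatrix_nonneg hβ ω i j

lemma IsSymmBernoulli.expectedMatrix_le [IsProbabilityMeasure μ] (h : IsSymmBernoulli μ a p)
    {β : Fin (t + 1) → ℝ} (hβ : ∀ k, 0 ≤ β k) (hsum : ∑ k, β k = 1) {α : ℝ} (hα : 0 ≤ α)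
    (hp : ∀ k i j, i ≠ j → p k i j ≤ α) (i j : Fin n) :
    expectedMatrix μ (smoothedMatrix β a) i j ≤ α := by
  by_cases hij : i = j
  · subst hij; rw [h.expectedMatrix_diag]; exact hα
  · rw [h.expectedMatrix_apply β hij]
    have : ∑ k : Fin (t + 1), β k.rev = 1 := by
      rw [← hsum]; exact Fintype.sum_equiv Fin.revPerm _ _ (fun k => by simp)
    calc ∑ k : Fin (t + 1), β k.rev * p k i j ≤ ∑ k : Fin (t + 1), β k.rev * α :=
          Finset.sum_le_sum fun k _ => mul_le_mul_of_nonneg_left (hp k i j hij) (hβ _)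
      _ = α := by rw [← Finset.sum_mul, this, one_mul]

/-- Independence factors the exponential moment over times and pairs `i < j`, where the exponent is
proportional to `w i j + w j i`. The inequality `exp (x + y) ≤ (exp 2x + exp 2y) / 2` splits it back
over ordered pairs, so later weights need not be symmetric; its price is the `1 / 2` and the `2 * w
i j` in the definition of domination. -/
theorem IsSymmBernoulli.poissonDominated [IsProbabilityMeasure μ] (h : IsSymmBernoulli μ a p)
    {β : Fin (t + 1) → ℝ} (hβ : ∀ k, 0 ≤ β k) {b : ℝ} (hb : 0 < b) (hβb : ∀ k, β k ≤ b) :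
    PoissonDominated μ (fun ω => b⁻¹ • smoothedMatrix β a ω)
      (b⁻¹ • expectedMatrix μ (smoothedMatrix β a)) := by
  intro w
  let E := {e : Fin (t + 1) × Fin n × Fin n // e.2.1 < e.2.2}
  let c : E → ℝ := fun e => β e.1.1.rev / b * (w e.1.2.1 e.1.2.2 + w e.1.2.2 e.1.2.1)
  let Y : E → Ω → ℝ := fun e ω => a e.1.1 ω e.1.2.1 e.1.2.2
  have hsum : ∀ ω, ∑ i, ∑ j, w i j * (b⁻¹ • smoothedMatrix β a ω) i j
      = (∑ e : E, fun ω => c e * Y e ω) ω := by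
    intro ω
    rw [sum_sum_eq_sum_lt _ fun i => by simp [smoothedMatrix_apply, h.diag_zero], Finset.sum_apply,
      sum_subtype_lt (fun k i j => β k.rev / b * (w i j + w j i) * a k ω i j)]
    refine Finset.sum_congr rfl fun i _ => Finset.sum_congr rfl fun j _ => ?_
    split_ifs
    · simp only [Matrix.smul_apply, smul_eq_mul, h.smoothedMatrix_symm β ω i j]
      rw [← add_mul, smoothedMatrix_apply, Finset.mul_sum, Finset.mul_sum]
      refine Finset.sum_congr rfl fun k _ => ?_
      rw [div_eq_mul_inv]; ring
    · rfl
  have hYm : ∀ e, Measurable (Y e) := fun e => h.measurable _ _ _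
  have hind : iIndepFun (fun e ω => c e * Y e ω) μ :=
    h.indep.comp (fun e x => c e * x) fun e => measurable_const_mul (c e)
  have hint : Integrable (fun ω => Real.exp ((∑ e : E, fun ω => c e * Y e ω) ω)) μ := by
    refine Integrable.of_bound (Measurable.aestronglyMeasurable ?_) (Real.exp (∑ e, |c e|))
      (Filter.Eventually.of_forall fun ω => ?_)
    · simp only [Finset.sum_apply]; fun_prop
    · rw [Real.norm_eq_abs, abs_of_pos (Real.exp_pos _), Real.exp_le_exp, Finset.sum_apply]
      refine Finset.sum_le_sum fun e _ => ?_
      rcases h.zero_or_one e.1.1 ω e.1.2.1 e.1.2.2 with h | h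
      · simp [Y, h]
      · simpa [Y, h] using le_abs_self _
  refine ⟨by simpa only [hsum] using hint, ?_⟩
  simp only [hsum]
  have h1 : ∫ ω, Real.exp ((∑ e : E, fun ω => c e * Y e ω) ω) ∂μ = ∏ e, mgf (Y e) μ (c e) := by
    have := hind.mgf_sum (t := 1) (fun e => (hYm e).const_mul _) Finset.univ
    simp only [mgf, one_mul] at this ⊢
    exact this
  rw [h1]
  have h2 : ∀ e, mgf (Y e) μ (c e) ≤ Real.exp (p e.1.1 e.1.2.1 e.1.2.2 * (β e.1.1.rev / b *
      (1 / 2 * (Real.exp (2 * w e.1.2.1 e.1.2.2) - 1)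
        + 1 / 2 * (Real.exp (2 * w e.1.2.2 e.1.2.1) - 1)))) := by
    intro e
    have := mgf_le_of_zero_or_one (μ := μ) (fun ω => h.zero_or_one e.1.1 ω e.1.2.1 e.1.2.2)
      (hYm e) (c e)
    refine this.trans (Real.exp_le_exp.2 ?_)
    rw [show μ.real {ω | Y e ω = 1} = p e.1.1 e.1.2.1 e.1.2.2 from h.prob_one _ _ _ e.2.ne]
    have hp0 : 0 ≤ p e.1.1 e.1.2.1 e.1.2.2 := by
      rw [← h.prob_one _ _ _ e.2.ne]; exact measureReal_nonneg
    refine mul_le_mul_of_nonneg_left ?_ hp0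
    have hθ0 : 0 ≤ β e.1.1.rev / b := div_nonneg (hβ _) hb.le
    refine (exp_mul_sub_one_le hθ0 ((div_le_one hb).2 (hβb _))).trans ?_
    refine mul_le_mul_of_nonneg_left ?_ hθ0
    linarith [exp_add_le_half (w e.1.2.1 e.1.2.2) (w e.1.2.2 e.1.2.1)]
  refine (Finset.prod_le_prod (fun e _ => mgf_nonneg) fun e _ => h2 e).trans ?_
  have hR := sum_sum_eq_sum_lt (fun i j => (b⁻¹ • expectedMatrix μ (smoothedMatrix β a)) i j *
    (Real.exp (2 * w i j) - 1)) fun i => by simp [h.expectedMatrix_diag]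
  rw [hR, ← Real.exp_sum, sum_subtype_lt (fun k i j => p k i j * (β k.rev / b *
    (1 / 2 * (Real.exp (2 * w i j) - 1) + 1 / 2 * (Real.exp (2 * w j i) - 1)))), Real.exp_le_exp,
    Finset.mul_sum]
  refine Finset.sum_le_sum fun i _ => ?_
  rw [Finset.mul_sum]
  refine Finset.sum_le_sum fun j _ => ?_
  split_ifs with hij
  · simp only [Matrix.smul_apply, smul_eq_mul, h.expectedMatrix_symm β i j,
      h.expectedMatrix_apply β hij.ne]
    refine le_of_eq ?_
    trans ∑ k : Fin (t + 1), β k.rev * p k i j * (b⁻¹ *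
      (1 / 2 * (Real.exp (2 * w i j) - 1) + 1 / 2 * (Real.exp (2 * w j i) - 1)))
    · refine Finset.sum_congr rfl fun k _ => ?_
      rw [div_eq_mul_inv]; ring
    · rw [← Finset.sum_mul]; ring
  · simp

variable {X : Ω → Matrix (Fin n) (Fin n) ℝ} {m : Matrix (Fin n) (Fin n) ℝ}

/-- Chernoff's bound. -/
lemma PoissonDominated.tail (h : PoissonDominated μ X m) (w : Fin n → Fin n → ℝ) (τ : ℝ) :
    μ.real {ω | τ ≤ ∑ i, ∑ j, w i j * X ω i j} ≤
      Real.exp (1 / 2 * ∑ i, ∑ j, m i j * (Real.exp (2 * w i j) - 1) - τ) := by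
  have h1 := mul_meas_ge_le_integral_of_nonneg
    (Filter.Eventually.of_forall fun ω => (Real.exp_pos (∑ i, ∑ j, w i j * X ω i j)).le) (h w).1
    (Real.exp τ)
  simp only [Real.exp_le_exp] at h1
  rw [Real.exp_sub, le_div_iff₀ (Real.exp_pos _), mul_comm]
  exact h1.trans (h w).2

/-- Bernstein's bound. -/
lemma PoissonDominated.tail_sub (h : PoissonDominated μ X m) (hm : ∀ i j, 0 ≤ m i j)
    (w : Fin n → Fin n → ℝ) (hw : ∀ i j, |w i j| ≤ 1 / 2) (τ : ℝ) :
    μ.real {ω | τ ≤ ∑ i, ∑ j, w i j * (X ω i j - m i j)} ≤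
      Real.exp (2 * ∑ i, ∑ j, m i j * w i j ^ 2 - τ) := by
  have h1 := h.tail w (τ + ∑ i, ∑ j, w i j * m i j)
  have h2 : {ω | τ ≤ ∑ i, ∑ j, w i j * (X ω i j - m i j)}
      = {ω | τ + ∑ i, ∑ j, w i j * m i j ≤ ∑ i, ∑ j, w i j * X ω i j} := by
    ext ω
    simp only [Set.mem_ofPred_eq, mul_sub, Finset.sum_sub_distrib]
    constructor <;> intro h <;> linarith
  rw [h2]
  refine h1.trans (Real.exp_le_exp.2 ?_)
  rw [sub_add_eq_sub_sub_swap]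
  refine sub_le_sub_right ?_ _
  rw [Finset.mul_sum, Finset.mul_sum, ← Finset.sum_sub_distrib]
  refine Finset.sum_le_sum fun i _ => ?_
  rw [Finset.mul_sum, Finset.mul_sum, ← Finset.sum_sub_distrib]
  refine Finset.sum_le_sum fun j _ => ?_
  -- `exp u - 1 - u ≤ u²` at `u = 2w`, halved by the domination, gives the factor `2` in the
  -- variance term.
  have h3 := Real.abs_exp_sub_one_sub_id_le (x := 2 * w i j)
    (by rw [abs_mul, abs_two]; linarith [hw i j])
  have h4 := (abs_le.1 h3).2
  nlinarith [hm i j]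

end PoissonDomination

/-! ### A grid of vectors that detects Euclidean and spectral norms. -/

section Grid

/-- The integer vectors indexing a grid of the ball of radius `5 / 4`. -/
noncomputable def gridPoints (n : ℕ) : Finset (Fin n → ℤ) :=
  (Fintype.piFinset fun _ => Finset.Icc (-(25 * n : ℤ)) (25 * n)).filter
    fun z => ∑ i, z i ^ 2 ≤ 25 * (n : ℤ)

/-- The grid vector with mesh `1 / (4 √n)` of index `z`. -/
noncomputable def gridVec {n : ℕ} (z : Fin n → ℤ) (i : Fin n) : ℝ := z i / (4 * √n)

lemma sum_exp_neg_natAbs_le (N : ℕ) :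
    ∑ k ∈ Finset.Icc (-(N : ℤ)) N, Real.exp (-(k.natAbs : ℝ)) ≤ 4 := by
  have hgeo : ∀ N : ℕ, ∑ k ∈ Finset.range N, Real.exp (-(k : ℝ)) ≤ 2 := by
    intro N
    have h1 : ∀ k : ℕ, Real.exp (-(k : ℝ)) ≤ (1 / 2) ^ k := by
      intro k
      rw [← mul_neg_one, Real.exp_nat_mul]
      refine pow_le_pow_left₀ (Real.exp_pos _).le ?_ k
      rw [Real.exp_neg, one_div]
      exact inv_anti₀ two_pos (by linarith [Real.add_one_le_exp (1 : ℝ)])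
    refine (Finset.sum_le_sum fun k _ => h1 k).trans ?_
    rw [geom_sum_eq (by norm_num)]
    have : (0 : ℝ) < (1 / 2) ^ N := by positivity
    rw [div_le_iff_of_neg (by norm_num)]
    linarith
  have hsub : Finset.Icc (-(N : ℤ)) N ⊆
      (Finset.range (N + 1)).image (fun k : ℕ => (k : ℤ)) ∪
      (Finset.range (N + 1)).image (fun k : ℕ => -(k : ℤ)) := by
    intro k hk
    simp only [Finset.mem_Icc, Finset.mem_union, Finset.mem_image, Finset.mem_range] at *
    rcases le_total 0 k with h | h
    · exact Or.inl ⟨k.natAbs, by omega, by omega⟩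
    · exact Or.inr ⟨k.natAbs, by omega, by omega⟩
  refine (Finset.sum_le_sum_of_subset_of_nonneg hsub fun _ _ _ => (Real.exp_pos _).le).trans ?_
  have hu := Finset.sum_union_inter (s₁ := (Finset.range (N + 1)).image (fun k : ℕ => (k : ℤ)))
    (s₂ := (Finset.range (N + 1)).image (fun k : ℕ => -(k : ℤ)))
    (f := fun k : ℤ => Real.exp (-(k.natAbs : ℝ)))
  rw [Finset.sum_image (by intro a _ b _ h; simpa using h),
    Finset.sum_image (by intro a _ b _ h; simpa using h)] at hu
  simp only [Int.natAbs_neg, Int.natAbs_natCast] at hu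
  have h0 : 0 ≤ ∑ k ∈ (Finset.range (N + 1)).image (fun k : ℕ => (k : ℤ)) ∩
      (Finset.range (N + 1)).image (fun k : ℕ => -(k : ℤ)), Real.exp (-(k.natAbs : ℝ)) :=
    Finset.sum_nonneg fun _ _ => (Real.exp_pos _).le
  linarith [hgeo (N + 1)]

/-- For integers `|z_i| ≤ z_i²`, so each grid point has weight `exp (25n - ∑ |z_i|) ≥ 1`. The total
weight over the box factors over coordinates, and each factor is at most `4 ≤ e²`. -/
lemma card_gridPoints_le (n : ℕ) : ((gridPoints n).card : ℝ) ≤ Real.exp (27 * n) := by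
  have h1 : ∀ z ∈ gridPoints n, (1 : ℝ) ≤ Real.exp (25 * n) * ∏ i, Real.exp (-((z i).natAbs : ℝ)) := by
    intro z hz
    rw [gridPoints, Finset.mem_filter] at hz
    rw [← Real.exp_sum, ← Real.exp_add, Real.one_le_exp_iff, Finset.sum_neg_distrib]
    have : ∑ i, ((z i).natAbs : ℤ) ≤ 25 * n :=
      (Finset.sum_le_sum fun i _ => by
        rw [← Int.natAbs_sq]
        have := Nat.le_self_pow two_ne_zero (z i).natAbs
        exact_mod_cast this).trans hz.2
    have h2 : ∑ i, ((z i).natAbs : ℝ) ≤ 25 * n := by exact_mod_cast this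
    linarith
  calc ((gridPoints n).card : ℝ) = ∑ z ∈ gridPoints n, (1 : ℝ) := by simp
    _ ≤ ∑ z ∈ gridPoints n, Real.exp (25 * n) * ∏ i, Real.exp (-((z i).natAbs : ℝ)) :=
        Finset.sum_le_sum h1
    _ ≤ ∑ z ∈ Fintype.piFinset fun _ : Fin n => Finset.Icc (-(25 * n : ℤ)) (25 * n),
          Real.exp (25 * n) * ∏ i, Real.exp (-((z i).natAbs : ℝ)) :=
        Finset.sum_le_sum_of_subset_of_nonneg (Finset.filter_subset _ _) fun _ _ _ => by positivity
    _ = Real.exp (25 * n) *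
          (∑ k ∈ Finset.Icc (-(25 * n : ℤ)) (25 * n), Real.exp (-(k.natAbs : ℝ))) ^ n := by
        rw [← Finset.mul_sum, Finset.sum_prod_piFinset
          (Finset.Icc (-(25 * n : ℤ)) (25 * n)) fun _ k => Real.exp (-(k.natAbs : ℝ))]
        simp
    _ ≤ Real.exp (25 * n) * Real.exp 2 ^ n := by
        refine mul_le_mul_of_nonneg_left (pow_le_pow_left₀
          (Finset.sum_nonneg fun _ _ => (Real.exp_pos _).le) ?_ n) (Real.exp_pos _).le
        have := sum_exp_neg_natAbs_le (25 * n)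
        push_cast at this
        refine this.trans ?_
        have h := Real.add_one_le_exp (1 : ℝ)
        rw [show (2 : ℝ) = 1 + 1 by norm_num, Real.exp_add]
        nlinarith
    _ = Real.exp (27 * n) := by
        rw [← Real.exp_nat_mul, ← Real.exp_add]; congr 1; ring

lemma sum_gridVec_sq_le {n : ℕ} (hn : 0 < n) {z : Fin n → ℤ} (hz : z ∈ gridPoints n) :
    ∑ i, gridVec z i ^ 2 ≤ 25 / 16 := by
  rw [gridPoints, Finset.mem_filter] at hz
  have h2 : ∑ i, (z i : ℝ) ^ 2 ≤ 25 * n := by exact_mod_cast hz.2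
  have hn' : (0 : ℝ) < n := by exact_mod_cast hn
  simp only [gridVec, div_pow, mul_pow, Real.sq_sqrt hn'.le]
  rw [← Finset.sum_div, div_le_iff₀ (by positivity)]
  linarith

lemma exists_gridVec_near {n : ℕ} (hn : 0 < n) {x : Fin n → ℝ} (hx : ∑ i, x i ^ 2 ≤ 1) :
    ∃ z ∈ gridPoints n, ∑ i, (x i - gridVec z i) ^ 2 ≤ 1 / 16 := by
  have hn' : (0 : ℝ) < n := by exact_mod_cast hn
  have hs : 0 < 4 * √n := by positivity
  let z : Fin n → ℤ := fun i => ⌊4 * √n * x i⌋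
  have he : ∀ i, (x i - gridVec z i) ^ 2 ≤ 1 / (16 * n) := by
    intro i
    have h1 : x i - gridVec z i = (4 * √n * x i - ⌊4 * √n * x i⌋) / (4 * √n) := by
      simp only [gridVec, z]; field_simp
    rw [h1, div_pow, mul_pow, Real.sq_sqrt hn'.le]
    have h2 := Int.floor_le (4 * √n * x i)
    have h3 := Int.lt_floor_add_one (4 * √n * x i)
    rw [show (4 : ℝ) ^ 2 * n = 16 * n by norm_num]
    refine div_le_div_of_nonneg_right ?_ (by positivity)
    nlinarith
  have hsum : ∑ i, (x i - gridVec z i) ^ 2 ≤ 1 / 16 := by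
    refine (Finset.sum_le_sum fun i _ => he i).trans (le_of_eq ?_)
    rw [Finset.sum_const, Finset.card_univ, Fintype.card_fin, nsmul_eq_mul]
    field_simp
  have hgrid : ∑ i, gridVec z i ^ 2 ≤ 25 / 16 := by
    -- Young's inequality with the weights that reproduce `(1 + 1/4)² = 5/4 + 5/16`.
    have : ∀ i, gridVec z i ^ 2 ≤ 5 / 4 * x i ^ 2 + 5 * (x i - gridVec z i) ^ 2 := by
      intro i
      nlinarith [sq_nonneg (x i / 2 + 2 * (x i - gridVec z i))]
    have h2 := Finset.sum_le_sum fun i (_ : i ∈ Finset.univ) => this i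
    rw [Finset.sum_add_distrib, ← Finset.mul_sum, ← Finset.mul_sum] at h2
    linarith
  have hz2 : ∑ i, z i ^ 2 ≤ 25 * (n : ℤ) := by
    simp only [gridVec, div_pow, mul_pow, Real.sq_sqrt hn'.le] at hgrid
    rw [← Finset.sum_div, div_le_iff₀ (by positivity)] at hgrid
    have : ∑ i, (z i : ℝ) ^ 2 ≤ 25 * n := by linarith
    exact_mod_cast this
  refine ⟨z, ?_, hsum⟩
  rw [gridPoints, Finset.mem_filter, Fintype.mem_piFinset]
  refine ⟨fun i => ?_, hz2⟩
  have h1 : z i ^ 2 ≤ 25 * (n : ℤ) :=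
    (Finset.single_le_sum (f := fun i => z i ^ 2) (fun i _ => sq_nonneg _)
      (Finset.mem_univ i)).trans hz2
  rw [Finset.mem_Icc, ← abs_le]
  have h2 : |z i| ≤ z i ^ 2 := by
    rw [← sq_abs, ← Int.natCast_natAbs]
    exact_mod_cast Nat.le_self_pow two_ne_zero _
  exact h2.trans h1

/-- Test `g` against a grid vector within `1/4` of its direction: this loses at most a quarter of
the norm of `g`. -/
lemma sum_sq_le_of_grid {n : ℕ} (hn : 0 < n) {g : Fin n → ℝ} {B : ℝ}
    (h : ∀ z ∈ gridPoints n, ∑ i, gridVec z i * g i ≤ B) : ∑ i, g i ^ 2 ≤ (2 * B) ^ 2 := by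
  set S := ∑ i, g i ^ 2 with hS
  have hS0 : 0 ≤ S := Finset.sum_nonneg fun _ _ => sq_nonneg _
  rcases hS0.eq_or_lt with h0 | h0
  · rw [← h0]; positivity
  have hs : 0 < √S := Real.sqrt_pos.2 h0
  obtain ⟨z, hz, hz2⟩ := exists_gridVec_near hn (x := fun i => g i / √S) (by
    simp only [div_pow, Real.sq_sqrt hS0]
    rw [← Finset.sum_div, ← hS, div_self h0.ne'])
  have h1 := h z hz
  have h2 : ∑ i, (g i / √S - gridVec z i) * g i ≤ 1 / 4 * √S := by
    refine (Real.sum_mul_le_sqrt_mul_sqrt _ _ _).trans ?_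
    refine mul_le_mul_of_nonneg_right (Real.sqrt_le_iff.2 ⟨by norm_num, ?_⟩) (Real.sqrt_nonneg _)
    linarith
  have h3 : ∑ i, (g i / √S - gridVec z i) * g i = √S - ∑ i, gridVec z i * g i := by
    simp only [sub_mul, Finset.sum_sub_distrib]
    congr 1
    have : ∀ i, g i / √S * g i = g i ^ 2 / √S := fun i => by ring
    simp only [this]
    rw [← Finset.sum_div, ← hS, Real.div_sqrt]
  have h4 : √S ≤ 2 * B := by linarith
  rw [← Real.sq_sqrt hS0]
  exact pow_le_pow_left₀ hs.le h4 2

/-- Replacing two unit vectors by grid vectors at distance at most `1/4`, of norm at most `5/4`,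
costs `(5/16 + 1/4)‖F‖ = 9/16 ‖F‖`. Absorbing this on the left gives the constant `16/7 ≤ 3`. -/
lemma matrixSpectralNorm_le_of_grid {n : ℕ} (hn : 0 < n) (M : Matrix (Fin n) (Fin n) ℝ) {B : ℝ}
    (hB : 0 ≤ B) (h : ∀ z ∈ gridPoints n, ∀ z' ∈ gridPoints n,
      ∑ i, ∑ j, gridVec z i * gridVec z' j * M i j ≤ B) :
    matrixSpectralNorm M ≤ 3 * B := by
  rw [matrixSpectralNorm]
  set F := Matrix.toEuclideanCLM (n := Fin n) (𝕜 := ℝ) M with hF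
  have key : ∀ x y : EuclideanSpace ℝ (Fin n), ‖x‖ = 1 → ‖y‖ = 1 →
      inner ℝ x (F y) ≤ B + 9 / 16 * ‖F‖ := by
    intro x y hx hy
    have hnear : ∀ x : EuclideanSpace ℝ (Fin n), ‖x‖ = 1 → ∃ z ∈ gridPoints n,
        ‖x - WithLp.toLp 2 (gridVec z)‖ ≤ 1 / 4 := by
      intro x hx
      have hx2 : ∑ i, x i ^ 2 ≤ 1 := by
        have := EuclideanSpace.real_norm_sq_eq x
        rw [hx] at this; linarith
      obtain ⟨z, hz, h1⟩ := exists_gridVec_near hn hx2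
      refine ⟨z, hz, ?_⟩
      refine le_of_sq_le_sq ?_ (by norm_num)
      rw [EuclideanSpace.real_norm_sq_eq]
      exact h1.trans (by norm_num)
    obtain ⟨z, hz, hz1⟩ := hnear x hx
    obtain ⟨z', hz', hz1'⟩ := hnear y hy
    set u : EuclideanSpace ℝ (Fin n) := WithLp.toLp 2 (gridVec z)
    set v : EuclideanSpace ℝ (Fin n) := WithLp.toLp 2 (gridVec z')
    have hu : ‖u‖ ≤ 5 / 4 := by
      refine le_of_sq_le_sq ?_ (by norm_num)
      rw [EuclideanSpace.real_norm_sq_eq]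
      have := sum_gridVec_sq_le hn hz
      norm_num
      exact this
    have e : inner ℝ x (F y) = inner ℝ u (F v) + inner ℝ u (F (y - v)) + inner ℝ (x - u) (F y) := by
      simp only [map_sub, inner_sub_left, inner_sub_right]; ring
    have hN : 0 ≤ ‖F‖ := norm_nonneg _
    have b1 : inner ℝ u (F v) ≤ B := by
      refine le_trans (le_of_eq ?_) (h z hz z' hz')
      rw [hF, Matrix.inner_toEuclideanCLM]
      simp only [dotProduct, Matrix.mulVec, Finset.mul_sum, u, v]
      refine Finset.sum_congr rfl fun i _ => ?_
      refine Finset.sum_congr rfl fun j _ => ?_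
      ring
    have b2 : inner ℝ u (F (y - v)) ≤ 5 / 16 * ‖F‖ := by
      refine (real_inner_le_norm _ _).trans ?_
      calc ‖u‖ * ‖F (y - v)‖ ≤ 5 / 4 * (‖F‖ * (1 / 4)) := by
            refine mul_le_mul hu ((F.le_opNorm _).trans ?_) (norm_nonneg _) (by norm_num)
            exact mul_le_mul_of_nonneg_left hz1' hN
        _ = _ := by ring
    have b3 : inner ℝ (x - u) (F y) ≤ 1 / 4 * ‖F‖ := by
      refine (real_inner_le_norm _ _).trans ?_
      refine mul_le_mul hz1 ((F.le_opNorm _).trans ?_) (norm_nonneg _) (by norm_num)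
      rw [hy, mul_one]
    rw [e]; linarith
  have h2 : ‖F‖ ≤ B + 9 / 16 * ‖F‖ := by
    have h0 : 0 ≤ B + 9 / 16 * ‖F‖ := by positivity
    refine F.opNorm_le_of_unit_norm h0 fun y hy => ?_
    by_cases hz : F y = 0
    · rw [hz, norm_zero]; exact h0
    have hpos : 0 < ‖F y‖ := norm_pos_iff.2 hz
    have := key (‖F y‖⁻¹ • F y) y (by rw [norm_smul, norm_inv, norm_norm, inv_mul_cancel₀ hpos.ne'])
      hy
    rw [real_inner_smul_left, real_inner_self_eq_norm_sq, sq, ← mul_assoc,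
      inv_mul_cancel₀ hpos.ne', one_mul] at this
    exact this
  linarith

end Grid

/-! ### Heavy pairs: the deterministic bound from degrees and discrepancy. -/

section Heavy

/-- The identity up to the threshold `4`, and zero above it. -/
noncomputable def capped (z : ℝ) : ℝ := if z ≤ 4 then z else 0

lemma capped_nonneg {z : ℝ} (hz : 0 ≤ z) : 0 ≤ capped z := by
  unfold capped; split_ifs <;> simp [hz]

lemma capped_of_le {z : ℝ} (hz : z ≤ 4) : capped z = z := if_pos hz

/-- The terms below the cap form a geometric progression of ratio `2` whose largest member is at
most `4`. Thus a block bound that is geometric in one level can be summed over that level at no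
cost. -/
lemma sum_capped_mul_zpow_le {z : ℝ} (hz : 0 < z) (T : Finset ℤ) :
    ∑ t ∈ T, capped (z * 2 ^ t) ≤ 8 := by
  set m := Int.log 2 (4 / z) with hm
  have hle : ∀ t : ℤ, z * 2 ^ t ≤ 4 ↔ t ≤ m := by
    intro t
    have := Int.zpow_le_iff_le_log (b := 2) (by norm_num) (x := t) (r := 4 / z) (by positivity)
    rw [← hm] at this
    rw [← this, le_div_iff₀ hz, mul_comm]
    norm_cast
  have hm4 : z * 2 ^ m ≤ 4 := (hle m).2 le_rfl
  have h1 : ∀ t ∈ T, capped (z * 2 ^ t) ≤ if t ≤ m then 4 * (1 / 2 : ℝ) ^ (m - t).toNat else 0 := by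
    intro t _
    by_cases h : t ≤ m
    · rw [capped_of_le ((hle t).2 h), if_pos h]
      have e : (1 / 2 : ℝ) ^ (m - t).toNat = 2 ^ (t - m) := by
        rw [← zpow_natCast, Int.toNat_of_nonneg (by omega), one_div, inv_zpow, ← zpow_neg]
        congr 1; ring
      rw [e]
      calc z * 2 ^ t = z * 2 ^ m * 2 ^ (t - m) := by
            rw [mul_assoc, ← zpow_add₀ (by norm_num)]; congr 2; ring
        _ ≤ _ := mul_le_mul_of_nonneg_right hm4 (by positivity)
    · rw [if_neg h, capped, if_neg (by rwa [hle])]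
  refine (Finset.sum_le_sum h1).trans ?_
  rw [← Finset.sum_filter, ← Finset.mul_sum]
  have h2 : ∑ t ∈ T.filter (· ≤ m), (1 / 2 : ℝ) ^ (m - t).toNat
      = ∑ k ∈ (T.filter (· ≤ m)).image (fun t => (m - t).toNat), (1 / 2 : ℝ) ^ k := by
    rw [Finset.sum_image]
    intro a ha b hb hab
    simp only [Finset.coe_filter, Set.mem_ofPred_eq] at ha hb
    simp only at hab
    omega
  rw [h2]
  have h3 := summable_geometric_two.sum_le_tsum
    ((T.filter (· ≤ m)).image (fun t => (m - t).toNat)) (fun _ _ => by positivity)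
  rw [tsum_geometric_two] at h3
  linarith

lemma sum_capped_mul_zpow_neg_le {z : ℝ} (hz : 0 < z) (T : Finset ℤ) :
    ∑ t ∈ T, capped (z / 2 ^ t) ≤ 8 := by
  have h := sum_capped_mul_zpow_le hz (T.image Neg.neg)
  rw [Finset.sum_image (by intro a _ b _ h; simpa using h)] at h
  simpa only [zpow_neg, ← div_eq_mul_inv] using h

/-- The contribution of a pair of level sets of sizes `I ≤ J`, at the levels `S` and `T`, which have
`E` edges between them. -/
lemma block_bound {n q κ I J E S T a b : ℝ} (hn : 0 < n) (hq : 0 < q) (hκ : 1 ≤ κ) (hI : 1 ≤ I)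
    (hIJ : I ≤ J) (hE : 0 ≤ E) (hS : 0 < S) (hT : 0 < T) (hheavy : q < 4 * (S * T))
    (ha : a = I * S ^ 2 / n) (hb : b = J * T ^ 2 / n) (hb2 : b ≤ 2) (hdeg : E ≤ I * (κ * q ^ 2))
    (hdisc : E * Real.log (E / (Real.exp 1 * (q ^ 2 * I * J / n))) ≤
      κ * J * Real.log (Real.exp 1 * n / J)) :
    S * T * E / n ≤ 220 * κ * q * (a * b + a * capped (q * T / S) + b * capped (S / (q * T)) +
      b * capped (S / q) + a * capped (q / (S * T))) := by
  have hJ : 0 < J := by linarith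
  have hI0 : 0 < I := by linarith
  have ha0 : 0 < a := by rw [ha]; positivity
  have hb0 : 0 < b := by rw [hb]; positivity
  have hm : 0 < q ^ 2 * I * J / n := by positivity
  have c1 : 0 ≤ a * capped (q * T / S) := mul_nonneg ha0.le (capped_nonneg (by positivity))
  have c2 : 0 ≤ b * capped (S / (q * T)) := mul_nonneg hb0.le (capped_nonneg (by positivity))
  have c3 : 0 ≤ b * capped (S / q) := mul_nonneg hb0.le (capped_nonneg (by positivity))
  have c4 : 0 ≤ a * capped (q / (S * T)) := mul_nonneg ha0.le (capped_nonneg (by positivity))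
  have c0 : 0 ≤ a * b := by positivity
  set l := E / (q ^ 2 * I * J / n) with hl
  have hl0 : 0 ≤ l := by positivity
  have hEl : E = l * (q ^ 2 * I * J / n) := by rw [hl]; field_simp
  set Q := S * T * E / (n * q) with hQ
  have hQ1 : S * T * E / n = q * Q := by rw [hQ]; field_simp
  have hQ2 : Q = a * b * (l * (q / (S * T))) := by
    rw [hQ, hEl, ha, hb]; field_simp
  have hQ0 : 0 ≤ Q := by positivity
  have hr4 : q / (S * T) ≤ 4 := by rw [div_le_iff₀ (by positivity)]; linarith
  rw [hQ1]
  suffices H : Q ≤ 220 * κ * (a * b + a * capped (q * T / S) + b * capped (S / (q * T)) +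
      b * capped (S / q) + a * capped (q / (S * T))) by
    calc q * Q ≤ q * _ := mul_le_mul_of_nonneg_left H hq.le
      _ = _ := by ring
  have fin : ∀ {k z : ℝ}, Q ≤ k * z → 0 ≤ z → k ≤ 220 * κ → z ≤ (a * b + a * capped (q * T / S) +
      b * capped (S / (q * T)) + b * capped (S / q) + a * capped (q / (S * T))) →
      Q ≤ 220 * κ * (a * b + a * capped (q * T / S) + b * capped (S / (q * T)) +
      b * capped (S / q) + a * capped (q / (S * T))) := by
    intro k z h1 h2 h3 h4
    calc Q ≤ k * z := h1
      _ ≤ 220 * κ * z := mul_le_mul_of_nonneg_right h3 h2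
      _ ≤ _ := mul_le_mul_of_nonneg_left h4 (by positivity)
  have he : Real.exp 1 < 2.7182818286 := Real.exp_one_lt_d9
  have he4 : Real.exp 4 ≤ 55 := by
    have : Real.exp 4 = Real.exp 1 ^ 4 := by rw [← Real.exp_nat_mul]; norm_num
    rw [this]
    calc Real.exp 1 ^ 4 ≤ 2.7182818286 ^ 4 := pow_le_pow_left₀ (Real.exp_pos _).le he.le 4
      _ ≤ 55 := by norm_num
  -- `l` is the ratio of the edge count to the reference value `q²IJ/n`. If it is bounded, `Q = ab ·
  -- l · q/(ST)` and the heaviness bound `q/(ST) ≤ 4` suffice: `220 = 55 · 4`.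
  by_cases hA : l ≤ Real.exp 4
  · refine fin (k := 220) (z := a * b) ?_ c0 (by linarith) (by linarith)
    rw [hQ2, mul_comm]
    refine mul_le_mul_of_nonneg_right ?_ c0
    calc l * (q / (S * T)) ≤ 55 * 4 := mul_le_mul (hA.trans he4) hr4 (by positivity) (by norm_num)
      _ = 220 := by norm_num
  push Not at hA
  have hlpos : 0 < l := (Real.exp_pos 4).trans hA
  have hlog4 : 4 < Real.log l := by rwa [Real.lt_log_iff_exp_lt hlpos]
  -- For `S` at least `qT` the degree bound alone suffices. Below, discrepancy is needed.
  by_cases hB : q * T / S ≤ 1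
  · refine fin (k := κ) (z := a * capped (q * T / S)) ?_ c1 (by linarith) (by linarith)
    rw [capped_of_le (by linarith), hQ]
    calc S * T * E / (n * q) ≤ S * T * (I * (κ * q ^ 2)) / (n * q) := by gcongr
      _ = _ := by rw [ha]; field_simp
  push Not at hB
  set v := S / (q * T) with hv
  have hv0 : 0 < v := by positivity
  have hv1 : v ≤ 1 := by
    rw [hv, div_le_one (by positivity)]; rw [lt_div_iff₀ hS] at hB; linarith
  set H := Real.log (Real.exp 1 * n / J) with hH
  have hHb : Real.exp 1 * n / J = Real.exp 1 * T ^ 2 / b := by rw [hb]; field_simp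
  have hdisc' : Q * (Real.log l - 1) ≤ κ * (b * v) * H := by
    have e1 : Real.log (E / (Real.exp 1 * (q ^ 2 * I * J / n))) = Real.log l - 1 := by
      rw [show E / (Real.exp 1 * (q ^ 2 * I * J / n)) = l / Real.exp 1 by rw [hl]; field_simp,
        Real.log_div hlpos.ne' (Real.exp_pos _).ne', Real.log_exp]
    rw [e1] at hdisc
    have := mul_le_mul_of_nonneg_left hdisc (show 0 ≤ S * T / (n * q) by positivity)
    calc Q * (Real.log l - 1) = S * T / (n * q) * (E * (Real.log l - 1)) := by rw [hQ]; ring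
      _ ≤ _ := this
      _ = _ := by rw [hb, hv]; field_simp
  have hdisc3 : Q * Real.log l * (3 / 4) ≤ κ * (b * v) * H := by
    have := mul_nonneg hQ0 (show 0 ≤ Real.log l / 4 - 1 by linarith)
    linarith
  -- If `log l` dominates the entropy factor `H`, the two cancel in the discrepancy bound. Otherwise
  -- `l` itself is small: `l⁴ < e T² / b`.
  by_cases hC : H / 4 ≤ Real.log l
  · refine fin (k := 16 / 3 * κ) (z := b * capped v) ?_ c2 (by linarith) (by linarith)
    rw [capped_of_le (by linarith)]
    have hpos : 0 < κ * (b * v) := by positivity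
    have : Q * Real.log l * (3 / 4) ≤ κ * (b * v) * (4 * Real.log l) :=
      hdisc3.trans (mul_le_mul_of_nonneg_left (by linarith) hpos.le)
    have h2 : Q * (3 / 4) * Real.log l ≤ κ * (b * v) * 4 * Real.log l := by linarith
    have := le_of_mul_le_mul_right h2 (by linarith)
    linarith
  push Not at hC
  have hl4 : l ^ 4 < Real.exp 1 * T ^ 2 / b := by
    rw [← Real.log_lt_log_iff (by positivity) (by positivity), Real.log_pow, ← hHb]
    push_cast; linarith
  -- Here `1/b ≤ T²`, so both `l` and `H` are of order `T`. For `S/q ≤ 4` discrepancy with `log l >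
  -- 4` concludes; for larger `S` the formula for `Q` with `l ≤ 2T` does.
  by_cases hD : 1 ≤ b * T ^ 2
  · have hle : Real.exp 1 * T ^ 2 / b ≤ Real.exp 1 * T ^ 4 := by
      rw [div_le_iff₀ hb0]
      have := mul_le_mul_of_nonneg_left hD (show 0 ≤ Real.exp 1 * T ^ 2 by positivity)
      linarith
    have hl2T : l ≤ 2 * T := by
      refine le_of_pow_le_pow_left₀ (n := 4) (by norm_num) (by positivity) ?_
      have := mul_le_mul_of_nonneg_right (show Real.exp 1 ≤ 16 by linarith)
        (show 0 ≤ T ^ 4 by positivity)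
      rw [mul_pow]
      linarith
    by_cases hF : S / q ≤ 4
    · refine fin (k := 4 / 3 * κ) (z := b * capped (S / q)) ?_ c3 (by linarith) (by linarith)
      rw [capped_of_le hF]
      have hHT : H ≤ 4 * T := by
        rw [hH, hHb]
        calc Real.log (Real.exp 1 * T ^ 2 / b) ≤ Real.log (Real.exp 1 * T ^ 4) :=
              Real.log_le_log (by positivity) hle
          _ = 1 + 4 * Real.log T := by
              rw [Real.log_mul (Real.exp_pos _).ne' (by positivity), Real.log_exp, Real.log_pow]
              norm_num
          _ ≤ 4 * T := by linarith [Real.log_le_sub_one_of_pos hT]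
      have h1 : Q * 3 ≤ κ * (b * v) * (4 * T) :=
        calc Q * 3 ≤ Q * Real.log l * (3 / 4) := by
              have := mul_le_mul_of_nonneg_left hlog4.le hQ0
              linarith
          _ ≤ κ * (b * v) * H := hdisc3
          _ ≤ _ := mul_le_mul_of_nonneg_left hHT (by positivity)
      have h2 : κ * (b * v) * (4 * T) = 4 * κ * (b * (S / q)) := by rw [hv]; field_simp
      linarith
    · push Not at hF
      refine fin (k := 1) (z := a * b) ?_ c0 (by linarith) (by linarith)
      rw [hQ2, one_mul]
      refine mul_le_of_le_one_right c0 ?_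
      rw [lt_div_iff₀ hq] at hF
      calc l * (q / (S * T)) ≤ 2 * T * (q / (S * T)) :=
            mul_le_mul_of_nonneg_right hl2T (by positivity)
        _ = 2 * q / S := by field_simp
        _ ≤ 1 := by rw [div_le_one hS]; linarith
  · push Not at hD
    refine fin (k := 2) (z := a * capped (q / (S * T))) ?_ c4 (by linarith) (by linarith)
    rw [capped_of_le hr4, hQ2]
    -- From `l⁴ b < e T²` and `b T² < 1` one gets `l⁴ b² < e`; then `b ≤ 2` gives `(lb)⁴ < 4e < 16`.
    have hlb : l * b ≤ 2 := by
      refine le_of_pow_le_pow_left₀ (n := 4) (by norm_num) (by norm_num) ?_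
      rw [lt_div_iff₀ hb0] at hl4
      have h1 : l ^ 4 * b ^ 2 < Real.exp 1 := by
        have h3 := mul_lt_mul_of_pos_right hl4 hb0
        have h4 := mul_lt_mul_of_pos_left hD (Real.exp_pos 1)
        linarith
      have h2 : b ^ 2 ≤ 4 := (pow_le_pow_left₀ hb0.le hb2 2).trans (by norm_num)
      have h3 : 0 ≤ l ^ 4 * b ^ 2 := by positivity
      calc (l * b) ^ 4 = l ^ 4 * b ^ 2 * b ^ 2 := by ring
        _ ≤ 2.7182818286 * 4 := mul_le_mul (by linarith) h2 (by positivity) (by norm_num)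
        _ ≤ 2 ^ 4 := by norm_num
    have : 0 ≤ a * (q / (S * T)) := by positivity
    calc a * b * (l * (q / (S * T))) = l * b * (a * (q / (S * T))) := by ring
      _ ≤ 2 * (a * (q / (S * T))) := mul_le_mul_of_nonneg_right hlb this

/-- The number of edges from `I` to `J` is not much larger than its mean allows. -/
def BoundedDiscrepancy {n : ℕ} (X : Matrix (Fin n) (Fin n) ℝ) (Δ κ : ℝ) : Prop :=
  ∀ I J : Finset (Fin n), I.Nonempty → I.card ≤ J.card →
    (∑ i ∈ I, ∑ j ∈ J, X i j) *
      Real.log ((∑ i ∈ I, ∑ j ∈ J, X i j) / (Real.exp 1 * (Δ * I.card * J.card / n))) ≤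
    κ * J.card * Real.log (Real.exp 1 * n / J.card)

/-- The dyadic level of the coordinate `i` of `x`. -/
noncomputable def level {n : ℕ} (x : Fin n → ℝ) (i : Fin n) : ℤ := Int.log 2 (√n * x i)

/-- The coordinates where `x` is positive and has dyadic level `s`. -/
noncomputable def levelSet {n : ℕ} (x : Fin n → ℝ) (s : ℤ) : Finset (Fin n) :=
  Finset.univ.filter fun i => 0 < x i ∧ level x i = s

lemma zpow_level_le {n : ℕ} (hn : 0 < n) {x : Fin n → ℝ} {i : Fin n} (hi : 0 < x i) :
    (2 : ℝ) ^ level x i ≤ √n * x i :=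
  Int.zpow_log_le_self (b := 2) (by norm_num) (by positivity)

lemma lt_zpow_level {n : ℕ} (x : Fin n → ℝ) (i : Fin n) :
    √n * x i < 2 * (2 : ℝ) ^ level x i := by
  have := Int.lt_zpow_succ_log_self (b := 2) (by norm_num) (√n * x i)
  rw [zpow_add₀ (by norm_num)] at this
  unfold level
  push_cast at this
  linarith

lemma sum_card_levelSet_le {n : ℕ} (hn : 0 < n) {x : Fin n → ℝ} (S : Finset ℤ) {R : ℝ}
    (hx : ∑ i, x i ^ 2 ≤ R) :
    ∑ s ∈ S, (levelSet x s).card * ((2 : ℝ) ^ s) ^ 2 / n ≤ R := by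
  have hn' : (0 : ℝ) < n := by exact_mod_cast hn
  have h1 : ∀ s ∈ S, (levelSet x s).card * ((2 : ℝ) ^ s) ^ 2 / n ≤ ∑ i ∈ levelSet x s, x i ^ 2 := by
    intro s _
    rw [mul_div_assoc, ← nsmul_eq_mul, ← Finset.sum_const]
    refine Finset.sum_le_sum fun i hi => ?_
    simp only [levelSet, Finset.mem_filter, Finset.mem_univ, true_and] at hi
    have := zpow_level_le hn hi.1
    rw [hi.2] at this
    rw [div_le_iff₀ hn']
    calc ((2 : ℝ) ^ s) ^ 2 ≤ (√n * x i) ^ 2 := pow_le_pow_left₀ (by positivity) this 2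
      _ = x i ^ 2 * n := by rw [mul_pow, Real.sq_sqrt hn'.le]; ring
  refine (Finset.sum_le_sum h1).trans (le_trans ?_ hx)
  rw [← Finset.sum_biUnion]
  · exact Finset.sum_le_sum_of_subset_of_nonneg (Finset.subset_univ _) fun _ _ _ => sq_nonneg _
  · intro s _ s' _ hss
    rw [Function.onFun, Finset.disjoint_left]
    intro i hi hi'
    simp only [levelSet, Finset.mem_filter, Finset.mem_univ, true_and] at hi hi'
    exact hss (hi.2.symm.trans hi'.2)

/-- Group the coordinates into dyadic level sets and apply `block_bound` to each pair of levels.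
Each term of that bound is a mass `a s` or `b t`, with total at most `2`, times either the other
mass or a capped geometric factor in the other level, so the double sum is bounded with no loss from
the number of levels. -/
lemma sum_heavy_le_of_card_le {n : ℕ} (hn : 0 < n) {X : Matrix (Fin n) (Fin n) ℝ} {q κ : ℝ}
    (hX : ∀ i j, 0 ≤ X i j) (hq : 0 < q) (hκ : 1 ≤ κ)
    (hdeg : ∀ i, ∑ j, X i j ≤ κ * q ^ 2) (hdisc : BoundedDiscrepancy X (q ^ 2) κ)
    {x y : Fin n → ℝ} (hx0 : ∀ i, 0 ≤ x i) (hy0 : ∀ i, 0 ≤ y i)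
    (hx : ∑ i, x i ^ 2 ≤ 2) (hy : ∑ i, y i ^ 2 ≤ 2) :
    ∑ i, ∑ j, (if q / n < x i * y j ∧
      (levelSet x (level x i)).card ≤ (levelSet y (level y j)).card then x i * y j * X i j else 0) ≤
      60000 * κ * q := by
  have hn' : (0 : ℝ) < n := by exact_mod_cast hn
  set F : Fin n → Fin n → ℝ := fun i j => if q / n < x i * y j ∧
      (levelSet x (level x i)).card ≤ (levelSet y (level y j)).card then x i * y j * X i j else 0
    with hF
  set ST := Finset.univ.image (level x) with hST
  set TT := Finset.univ.image (level y) with hTT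
  set a : ℤ → ℝ := fun s => (levelSet x s).card * ((2 : ℝ) ^ s) ^ 2 / n with ha
  set b : ℤ → ℝ := fun t => (levelSet y t).card * ((2 : ℝ) ^ t) ^ 2 / n with hb
  have ha0 : ∀ s, 0 ≤ a s := fun s => by simp only [ha]; positivity
  have hb0 : ∀ s, 0 ≤ b s := fun s => by simp only [hb]; positivity
  have hsa : ∑ s ∈ ST, a s ≤ 2 := sum_card_levelSet_le hn ST hx
  have hsb : ∑ t ∈ TT, b t ≤ 2 := sum_card_levelSet_le hn TT hy
  set B : ℤ → ℤ → ℝ := fun s t => a s * b t + a s * capped (q * 2 ^ t / 2 ^ s) +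
    b t * capped (2 ^ s / (q * 2 ^ t)) + b t * capped (2 ^ s / q) +
    a s * capped (q / (2 ^ s * 2 ^ t)) with hB
  have hB0 : ∀ s t, 0 ≤ B s t := by
    intro s t
    have h1 := mul_nonneg (ha0 s) (hb0 t)
    have h2 := mul_nonneg (ha0 s) (capped_nonneg (z := q * 2 ^ t / 2 ^ s) (by positivity))
    have h3 := mul_nonneg (hb0 t) (capped_nonneg (z := 2 ^ s / (q * 2 ^ t)) (by positivity))
    have h4 := mul_nonneg (hb0 t) (capped_nonneg (z := 2 ^ s / q) (by positivity))
    have h5 := mul_nonneg (ha0 s) (capped_nonneg (z := q / (2 ^ s * 2 ^ t)) (by positivity))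
    simp only [hB]; linarith
  have hblock : ∀ s ∈ ST, ∀ t ∈ TT, ∑ i with level x i = s, ∑ j with level y j = t, F i j ≤
      4 * (220 * κ * q * B s t) := by
    intro s _ t ht
    by_cases hP : q < 4 * ((2 : ℝ) ^ s * 2 ^ t) ∧ (levelSet x s).card ≤ (levelSet y t).card ∧
        (levelSet x s).Nonempty
    · obtain ⟨hP1, hP2, hP3⟩ := hP
      have hbl := block_bound (n := n) (q := q) (κ := κ) (I := (levelSet x s).card)
        (J := (levelSet y t).card) (E := ∑ i ∈ levelSet x s, ∑ j ∈ levelSet y t, X i j)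
        (S := 2 ^ s) (T := 2 ^ t) (a := a s) (b := b t) hn' hq hκ
        (by exact_mod_cast hP3.card_pos) (by exact_mod_cast hP2)
        (Finset.sum_nonneg fun i _ => Finset.sum_nonneg fun j _ => hX i j) (by positivity)
        (by positivity) hP1 rfl rfl
        ((Finset.single_le_sum (f := b) (fun t _ => hb0 t) ht).trans hsb)
        (by
          rw [← nsmul_eq_mul, ← Finset.sum_const]
          refine Finset.sum_le_sum fun i _ => le_trans ?_ (hdeg i)
          exact Finset.sum_le_sum_of_subset_of_nonneg (Finset.subset_univ _) fun j _ _ => hX i j)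
        (hdisc _ _ hP3 hP2)
      refine le_trans ?_ (mul_le_mul_of_nonneg_left hbl (by norm_num))
      -- A positive coordinate is less than twice its dyadic level, whence the factor `4` for a
      -- product. The fibers of `level` also contain zero coordinates, where `F` vanishes.
      have hFle : ∀ i j, level x i = s → level y j = t → F i j ≤
          if 0 < x i ∧ level x i = s then (if 0 < y j ∧ level y j = t then
            4 * ((2 : ℝ) ^ s * 2 ^ t / n) * X i j else 0) else 0 := by
        intro i j hi hj
        rcases (hx0 i).eq_or_lt with h | hxi
        · simp [hF, ← h]
        rcases (hy0 j).eq_or_lt with h | hyj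
        · simp [hF, ← h]
        rw [if_pos ⟨hxi, hi⟩, if_pos ⟨hyj, hj⟩]
        have h1 := (lt_zpow_level x i).le
        have h2 := (lt_zpow_level y j).le
        rw [hi] at h1
        rw [hj] at h2
        have h3 := mul_le_mul h1 h2 (by positivity) (by positivity)
        have h4 : x i * y j ≤ 4 * ((2 : ℝ) ^ s * 2 ^ t / n) := by
          rw [← mul_div_assoc, le_div_iff₀ hn']
          calc x i * y j * n = √n * x i * (√n * y j) := by
                rw [show √n * x i * (√n * y j) = x i * y j * (√n * √n) by ring,
                  Real.mul_self_sqrt hn'.le]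
            _ ≤ _ := h3
            _ = _ := by ring
        have h5 := mul_le_mul_of_nonneg_right h4 (hX i j)
        simp only [hF]
        split_ifs
        · exact h5
        · exact mul_nonneg (by positivity) (hX i j)
      calc ∑ i with level x i = s, ∑ j with level y j = t, F i j
          ≤ ∑ i with level x i = s, ∑ j with level y j = t,
            if 0 < x i ∧ level x i = s then (if 0 < y j ∧ level y j = t then
            4 * ((2 : ℝ) ^ s * 2 ^ t / n) * X i j else 0) else 0 := by
            refine Finset.sum_le_sum fun i hi => Finset.sum_le_sum fun j hj => ?_
            exact hFle i j (Finset.mem_filter.1 hi).2 (Finset.mem_filter.1 hj).2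
        _ ≤ ∑ i, ∑ j,
            if 0 < x i ∧ level x i = s then (if 0 < y j ∧ level y j = t then
            4 * ((2 : ℝ) ^ s * 2 ^ t / n) * X i j else 0) else 0 := by
            have hnn : ∀ i j, (0 : ℝ) ≤ if 0 < x i ∧ level x i = s then (if 0 < y j ∧ level y j = t
              then 4 * ((2 : ℝ) ^ s * 2 ^ t / n) * X i j else 0) else 0 := by
              intro i j
              have := mul_nonneg (show (0 : ℝ) ≤ 4 * ((2 : ℝ) ^ s * 2 ^ t / n) by positivity)
                (hX i j)
              split_ifs <;> first | exact this | exact le_rfl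
            refine (Finset.sum_le_sum fun i _ => Finset.sum_le_sum_of_subset_of_nonneg
              (Finset.subset_univ _) fun j _ _ => hnn i j).trans ?_
            exact Finset.sum_le_sum_of_subset_of_nonneg (Finset.subset_univ _)
              fun i _ _ => Finset.sum_nonneg fun j _ => hnn i j
        _ = 4 * ((2 : ℝ) ^ s * 2 ^ t * (∑ i ∈ levelSet x s, ∑ j ∈ levelSet y t, X i j) / n) := by
            have ex : levelSet x s = Finset.univ.filter fun i => 0 < x i ∧ level x i = s := rfl
            have ey : levelSet y t = Finset.univ.filter fun j => 0 < y j ∧ level y j = t := rfl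
            rw [show ∀ e : ℝ, 4 * ((2 : ℝ) ^ s * 2 ^ t * e / n) = 4 * ((2 : ℝ) ^ s * 2 ^ t / n) * e
              from fun e => by ring, Finset.mul_sum, ex, Finset.sum_filter]
            refine Finset.sum_congr rfl fun i _ => ?_
            by_cases hi : 0 < x i ∧ level x i = s
            · simp only [if_pos hi]
              rw [ey, Finset.sum_filter, Finset.mul_sum]
              refine Finset.sum_congr rfl fun j _ => ?_
              split_ifs <;> simp
            · simp only [if_neg hi, Finset.sum_const_zero]
    · refine le_trans (le_of_eq ?_) (mul_nonneg (by norm_num)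
        (mul_nonneg (by positivity) (hB0 s t)))
      refine Finset.sum_eq_zero fun i hi => Finset.sum_eq_zero fun j hj => ?_
      have hi' : level x i = s := (Finset.mem_filter.1 hi).2
      have hj' : level y j = t := (Finset.mem_filter.1 hj).2
      simp only [hF]
      refine if_neg fun hc => hP ?_
      have hxy : 0 < x i * y j := lt_trans (by positivity) hc.1
      have hxi : 0 < x i := (hx0 i).lt_of_ne fun h => by rw [← h, zero_mul] at hxy; exact hxy.false
      rw [hi', hj'] at hc
      refine ⟨?_, hc.2, i, by simp [levelSet, hxi, hi']⟩
      have h1 := (lt_zpow_level x i).le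
      have h2 := (lt_zpow_level y j).le
      rw [hi'] at h1
      rw [hj'] at h2
      have h3 := mul_le_mul h1 h2 (mul_nonneg (Real.sqrt_nonneg _) (hy0 j)) (by positivity)
      have h4 := hc.1
      rw [div_lt_iff₀ hn'] at h4
      calc q < x i * y j * n := h4
        _ = √n * x i * (√n * y j) := by
            rw [show √n * x i * (√n * y j) = x i * y j * (√n * √n) by ring,
              Real.mul_self_sqrt hn'.le]
        _ ≤ _ := h3
        _ = _ := by ring
  have hsum : ∑ i, ∑ j, F i j = ∑ s ∈ ST, ∑ t ∈ TT,
      ∑ i with level x i = s, ∑ j with level y j = t, F i j := by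
    rw [← Finset.sum_fiberwise_of_maps_to (s := Finset.univ) (t := ST) (g := level x)
      (fun i _ => Finset.mem_image_of_mem _ (Finset.mem_univ i))]
    refine Finset.sum_congr rfl fun s _ => ?_
    symm
    rw [Finset.sum_comm]
    refine Finset.sum_congr rfl fun i _ => ?_
    exact Finset.sum_fiberwise_of_maps_to (s := Finset.univ) (t := TT) (g := level y)
      (fun i _ => Finset.mem_image_of_mem _ (Finset.mem_univ i)) _
  rw [hsum]
  refine (Finset.sum_le_sum fun s hs => Finset.sum_le_sum fun t ht => hblock s hs t ht).trans ?_
  -- The product of masses gives `2 · 2`, and each of the four capped terms `2 · 8`. Then `4 · 220 ·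
  -- 68 ≤ 60000`.
  have hBsum : ∑ s ∈ ST, ∑ t ∈ TT, B s t ≤ 68 := by
    have hsa0 : 0 ≤ ∑ s ∈ ST, a s := Finset.sum_nonneg fun s _ => ha0 s
    have e1 : ∑ s ∈ ST, ∑ t ∈ TT, a s * b t ≤ 4 := by
      rw [← Finset.sum_mul_sum]
      have hsb0 : 0 ≤ ∑ s ∈ TT, b s := Finset.sum_nonneg fun s _ => hb0 s
      nlinarith
    have g1 : ∀ f : ℤ → ℤ → ℝ, (∀ s, ∑ t ∈ TT, f s t ≤ 8) →
        ∑ s ∈ ST, ∑ t ∈ TT, a s * f s t ≤ 16 := by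
      intro f hf
      calc ∑ s ∈ ST, ∑ t ∈ TT, a s * f s t ≤ ∑ s ∈ ST, a s * 8 := by
            refine Finset.sum_le_sum fun s _ => ?_
            rw [← Finset.mul_sum]
            exact mul_le_mul_of_nonneg_left (hf s) (ha0 s)
        _ ≤ 16 := by rw [← Finset.sum_mul]; linarith
    have g2 : ∀ f : ℤ → ℤ → ℝ, (∀ t, ∑ s ∈ ST, f s t ≤ 8) →
        ∑ s ∈ ST, ∑ t ∈ TT, b t * f s t ≤ 16 := by
      intro f hf
      rw [Finset.sum_comm]
      calc ∑ t ∈ TT, ∑ s ∈ ST, b t * f s t ≤ ∑ s ∈ TT, b s * 8 := by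
            refine Finset.sum_le_sum fun s _ => ?_
            rw [← Finset.mul_sum]
            exact mul_le_mul_of_nonneg_left (hf s) (hb0 s)
        _ ≤ 16 := by rw [← Finset.sum_mul]; linarith
    have e2 := g1 (fun s t => capped (q * 2 ^ t / 2 ^ s)) fun s => by
      have := sum_capped_mul_zpow_le (z := q / 2 ^ s) (by positivity) TT
      simpa only [div_mul_eq_mul_div] using this
    have e3 := g2 (fun s t => capped (2 ^ s / (q * 2 ^ t))) fun t => by
      have := sum_capped_mul_zpow_le (z := 1 / (q * 2 ^ t)) (by positivity) ST
      simpa only [div_mul_eq_mul_div, one_mul] using this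
    have e4 := g2 (fun s t => capped (2 ^ s / q)) fun t => by
      have := sum_capped_mul_zpow_le (z := 1 / q) (by positivity) ST
      simpa only [div_mul_eq_mul_div, one_mul] using this
    have e5 := g1 (fun s t => capped (q / (2 ^ s * 2 ^ t))) fun s => by
      have := sum_capped_mul_zpow_neg_le (z := q / 2 ^ s) (by positivity) TT
      simpa only [div_div] using this
    simp only [hB, Finset.sum_add_distrib]
    linarith
  simp only [← Finset.mul_sum]
  have h0 : 0 ≤ κ * q := by positivity
  nlinarith

/-- For every pair of level sets one is at most as large as the other, so by symmetry of `X` the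
previous bound for `(x, y)` and for `(y, x)` covers all heavy pairs. -/
lemma sum_heavy_le {n : ℕ} (hn : 0 < n) {X : Matrix (Fin n) (Fin n) ℝ} {q κ : ℝ}
    (hX : ∀ i j, 0 ≤ X i j) (hsymm : ∀ i j, X j i = X i j) (hq : 0 < q) (hκ : 1 ≤ κ)
    (hdeg : ∀ i, ∑ j, X i j ≤ κ * q ^ 2) (hdisc : BoundedDiscrepancy X (q ^ 2) κ)
    {x y : Fin n → ℝ} (hx : ∑ i, x i ^ 2 ≤ 2) (hy : ∑ i, y i ^ 2 ≤ 2) :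
    ∑ i, ∑ j, (if q / n < |x i * y j| then |x i * y j| * X i j else 0) ≤ 120000 * κ * q := by
  have h1 := sum_heavy_le_of_card_le hn hX hq hκ hdeg hdisc (x := fun i => |x i|)
    (y := fun i => |y i|) (fun _ => abs_nonneg _) (fun _ => abs_nonneg _) (by simpa using hx)
    (by simpa using hy)
  have h2 := sum_heavy_le_of_card_le hn hX hq hκ hdeg hdisc (x := fun i => |y i|)
    (y := fun i => |x i|) (fun _ => abs_nonneg _) (fun _ => abs_nonneg _) (by simpa using hy)
    (by simpa using hx)
  rw [Finset.sum_comm] at h2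
  have h3 := add_le_add h1 h2
  simp only [← Finset.sum_add_distrib] at h3
  refine le_trans (Finset.sum_le_sum fun i _ => Finset.sum_le_sum fun j _ => ?_)
    (h3.trans (by linarith))
  rw [hsymm i j, mul_comm |y j| |x i|, ← abs_mul]
  have h0 : 0 ≤ |x i * y j| * X i j := mul_nonneg (abs_nonneg _) (hX i j)
  by_cases hc : q / n < |x i * y j|
  · simp only [hc, true_and, if_true]
    rcases le_total (levelSet (fun i => |x i|) (level (fun i => |x i|) i)).card
      (levelSet (fun i => |y i|) (level (fun i => |y i|) j)).card with h | h
    · rw [if_pos h]; split_ifs <;> linarith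
    · rw [if_pos h]; split_ifs <;> linarith
  · simp only [hc, false_and, if_false, add_zero, le_refl]

end Heavy

/-! ### Bounded discrepancy with high probability. -/

section Discrepancy

/-- The exponent `r log (e n / r)`, which bounds the logarithm of the number of sets of size at most
`r` in a set of size `n`. -/
noncomputable def setEntropy (n r : ℕ) : ℝ := r * Real.log (Real.exp 1 * n / r)

/-- Weight each set `I` by `(n/r)^r (r/n)^|I|`, which is at least `1` when `|I| ≤ r`. By the
binomial theorem the total weight is `(n/r)^r (1 + r/n)^n ≤ (en/r)^r`. -/
lemma card_filter_card_le_exp_setEntropy {n r : ℕ} (hr : 0 < r) (hrn : r ≤ n) :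
    (((Finset.univ : Finset (Finset (Fin n))).filter fun I => I.card ≤ r).card : ℝ) ≤
      Real.exp (setEntropy n r) := by
  have hr' : (0 : ℝ) < r := by exact_mod_cast hr
  have hn' : (0 : ℝ) < n := by exact_mod_cast hr.trans_le hrn
  have hrn' : (r : ℝ) ≤ n := by exact_mod_cast hrn
  have h1 : ∀ I ∈ (Finset.univ : Finset (Finset (Fin n))).filter fun I => I.card ≤ r,
      (1 : ℝ) ≤ ((n : ℝ) / r) ^ r * ((r : ℝ) / n) ^ I.card := by
    intro I hI
    have h2 := pow_le_pow_of_le_one (a := (r : ℝ) / n) (by positivity)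
      ((div_le_one hn').2 hrn') (Finset.mem_filter.1 hI).2
    calc (1 : ℝ) = ((n : ℝ) / r) ^ r * ((r : ℝ) / n) ^ r := by
          rw [← mul_pow, div_mul_div_cancel₀ hr'.ne', div_self hn'.ne', one_pow]
      _ ≤ _ := mul_le_mul_of_nonneg_left h2 (by positivity)
  have h3 : ∑ I : Finset (Fin n), ((r : ℝ) / n) ^ I.card = ((r : ℝ) / n + 1) ^ n := by
    have := Finset.sum_pow_mul_eq_add_pow ((r : ℝ) / n) 1 (Finset.univ : Finset (Fin n))
    simpa using this
  calc (((Finset.univ : Finset (Finset (Fin n))).filter fun I => I.card ≤ r).card : ℝ)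
      = ∑ I ∈ (Finset.univ : Finset (Finset (Fin n))).filter fun I => I.card ≤ r, (1 : ℝ) := by simp
    _ ≤ ∑ I ∈ (Finset.univ : Finset (Finset (Fin n))).filter fun I => I.card ≤ r,
        ((n : ℝ) / r) ^ r * ((r : ℝ) / n) ^ I.card := Finset.sum_le_sum h1
    _ ≤ ∑ I : Finset (Fin n), ((n : ℝ) / r) ^ r * ((r : ℝ) / n) ^ I.card :=
        Finset.sum_le_sum_of_subset_of_nonneg (Finset.filter_subset _ _) fun _ _ _ => by positivity
    _ = ((n : ℝ) / r) ^ r * ((r : ℝ) / n + 1) ^ n := by rw [← Finset.mul_sum, h3]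
    _ ≤ ((n : ℝ) / r) ^ r * Real.exp ((r : ℝ) / n) ^ n := by
        refine mul_le_mul_of_nonneg_left (pow_le_pow_left₀ (by positivity)
          (Real.add_one_le_exp _) n) (by positivity)
    _ = Real.exp (setEntropy n r) := by
        rw [setEntropy, Real.exp_nat_mul, Real.exp_log (by positivity), ← Real.exp_nat_mul,
          mul_div_cancel₀ _ hn'.ne', mul_div_assoc, mul_pow, ← Real.exp_nat_mul, mul_one, mul_comm]

lemma le_setEntropy {n r : ℕ} (hr : 0 < r) (hrn : r ≤ n) : 1 + Real.log n ≤ setEntropy n r := by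
  have hr' : (1 : ℝ) ≤ r := by exact_mod_cast hr
  have hn' : (0 : ℝ) < n := by exact_mod_cast hr.trans_le hrn
  have hrn' : (r : ℝ) ≤ n := by exact_mod_cast hrn
  rw [setEntropy, Real.log_div (by positivity) (by positivity),
    Real.log_mul (Real.exp_pos _).ne' hn'.ne', Real.log_exp]
  have h1 := Real.log_le_log (by linarith) hrn'
  have h2 := Real.log_le_sub_one_of_pos (show (0 : ℝ) < r by linarith)
  nlinarith [mul_nonneg (sub_nonneg.2 hr') (sub_nonneg.2 h1)]

/-- One factor `exp (-setEntropy)` pays for the number of sets of a given size; the other is at most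
`1/n` and pays for the `n` possible sizes. -/
lemma sum_exp_neg_setEntropy_le (n : ℕ) :
    ∑ J ∈ (Finset.univ : Finset (Finset (Fin n))).filter (fun J => J.Nonempty),
      Real.exp (-2 * setEntropy n J.card) ≤ 1 := by
  rw [← Finset.sum_fiberwise_of_maps_to (t := Finset.Icc 1 n) (g := Finset.card)
    (fun J hJ => Finset.mem_Icc.2 ⟨(Finset.mem_filter.1 hJ).2.card_pos,
      J.card_le_univ.trans (by simp)⟩)]
  have h1 : ∀ r ∈ Finset.Icc 1 n,
      ∑ J ∈ ((Finset.univ : Finset (Finset (Fin n))).filter (fun J => J.Nonempty)).filter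
        (fun J => J.card = r), Real.exp (-2 * setEntropy n J.card) ≤ 1 / n := by
    intro r hr
    obtain ⟨hr1, hrn⟩ := Finset.mem_Icc.1 hr
    have hn' : (0 : ℝ) < n := by exact_mod_cast (show 0 < r from hr1).trans_le hrn
    calc _ = ∑ J ∈ ((Finset.univ : Finset (Finset (Fin n))).filter
            (fun J => J.Nonempty)).filter (fun J => J.card = r), Real.exp (-2 * setEntropy n r) :=
          Finset.sum_congr rfl fun J hJ => by rw [(Finset.mem_filter.1 hJ).2]
      _ ≤ ∑ J ∈ (Finset.univ : Finset (Finset (Fin n))).filter (fun J => J.card ≤ r),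
          Real.exp (-2 * setEntropy n r) := by
          refine Finset.sum_le_sum_of_subset_of_nonneg ?_ fun _ _ _ => (Real.exp_pos _).le
          intro J hJ
          simp only [Finset.mem_filter, Finset.mem_univ, true_and] at hJ ⊢
          exact hJ.2.le
      _ ≤ Real.exp (setEntropy n r) * Real.exp (-2 * setEntropy n r) := by
          rw [Finset.sum_const, nsmul_eq_mul]
          exact mul_le_mul_of_nonneg_right (card_filter_card_le_exp_setEntropy hr1 hrn)
            (Real.exp_pos _).le
      _ = Real.exp (-setEntropy n r) := by rw [← Real.exp_add]; congr 1; ring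
      _ ≤ Real.exp (-Real.log n) := Real.exp_le_exp.2 (by linarith [le_setEntropy hr1 hrn])
      _ = 1 / n := by rw [Real.exp_neg, Real.exp_log hn', one_div]
  refine (Finset.sum_le_sum h1).trans ?_
  rw [Finset.sum_const, Nat.card_Icc, nsmul_eq_mul, Nat.add_sub_cancel]
  rcases Nat.eq_zero_or_pos n with h | h
  · simp [h]
  · rw [mul_one_div, div_self (by positivity)]

variable {Ω : Type*} [MeasurableSpace Ω] {μ : Measure Ω} [IsProbabilityMeasure μ] {n : ℕ}
  {X : Ω → Matrix (Fin n) (Fin n) ℝ} {m : Matrix (Fin n) (Fin n) ℝ}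

lemma sum_indicator_mul (I J : Finset (Fin n)) (l : ℝ) (Y : Fin n → Fin n → ℝ) :
    ∑ i, ∑ j, (if i ∈ I ∧ j ∈ J then l else 0) * Y i j = l * ∑ i ∈ I, ∑ j ∈ J, Y i j := by
  rw [Finset.mul_sum, ← Finset.sum_filter_add_sum_filter_not Finset.univ (fun i => i ∈ I)]
  rw [Finset.sum_eq_zero (s := Finset.univ.filter fun i => i ∉ I), add_zero,
    Finset.filter_univ_mem]
  · refine Finset.sum_congr rfl fun i hi => ?_
    simp only [hi, true_and, ite_mul, zero_mul]
    rw [← Finset.sum_filter, Finset.filter_univ_mem, Finset.mul_sum]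
  · intro i hi
    have := (Finset.mem_filter.1 hi).2
    simp [this]

/-- The Poisson upper tail: Chernoff with weight `L/2` on `I × J`, where `L = log (τ/M)` is the
optimal Poisson tilt for mean `M`. The symmetrization halves the rate. -/
lemma PoissonDominated.tail_edges (h : PoissonDominated μ X m) {d : ℝ} (hd : 0 < d)
    (hmd : ∀ i j, m i j ≤ d / n) {I J : Finset (Fin n)} (hI : I.Nonempty) (hJ : J.Nonempty)
    {τ : ℝ} (hτ : d * I.card * J.card / n ≤ τ) :
    μ.real {ω | τ ≤ ∑ i ∈ I, ∑ j ∈ J, X ω i j} ≤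
      Real.exp (-(1 / 2 * (τ * Real.log (τ / (Real.exp 1 * (d * I.card * J.card / n)))))) := by
  have hn' : (0 : ℝ) < n := by
    obtain ⟨i, _⟩ := hI
    exact_mod_cast i.pos
  have hI' : (0 : ℝ) < I.card := by exact_mod_cast hI.card_pos
  have hJ' : (0 : ℝ) < J.card := by exact_mod_cast hJ.card_pos
  set M := d * I.card * J.card / n with hM
  have hM0 : 0 < M := by positivity
  have hτ0 : 0 < τ := hM0.trans_le hτ
  set L := Real.log (τ / M) with hL
  have hL0 : 0 ≤ L := Real.log_nonneg ((one_le_div hM0).2 hτ)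
  have hexp : Real.exp L = τ / M := Real.exp_log (by positivity)
  have h2 : Real.log (τ / (Real.exp 1 * M)) = L - 1 := by
    rw [mul_comm, ← div_div, Real.log_div (by positivity) (Real.exp_pos _).ne', Real.log_exp]
  rcases hL0.eq_or_lt with h0 | hLpos
  · refine measureReal_le_one.trans (Real.one_le_exp ?_)
    rw [h2, ← h0]; nlinarith
  have h1 := h.tail (fun i j => if i ∈ I ∧ j ∈ J then L / 2 else 0) (L / 2 * τ)
  have e1 : {ω | L / 2 * τ ≤ ∑ i, ∑ j, (if i ∈ I ∧ j ∈ J then L / 2 else 0) * X ω i j}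
      = {ω | τ ≤ ∑ i ∈ I, ∑ j ∈ J, X ω i j} := by
    ext ω
    rw [Set.mem_ofPred_eq, Set.mem_ofPred_eq, sum_indicator_mul I J (L / 2) fun i j => X ω i j]
    exact mul_le_mul_iff_right₀ (by positivity)
  rw [e1] at h1
  refine h1.trans (Real.exp_le_exp.2 ?_)
  have e2 : ∑ i, ∑ j, m i j * (Real.exp (2 * if i ∈ I ∧ j ∈ J then L / 2 else 0) - 1)
      = (Real.exp L - 1) * ∑ i ∈ I, ∑ j ∈ J, m i j := by
    rw [← sum_indicator_mul I J (Real.exp L - 1) fun i j => m i j]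
    refine Finset.sum_congr rfl fun i _ => Finset.sum_congr rfl fun j _ => ?_
    split_ifs
    · rw [mul_div_cancel₀ _ two_ne_zero, mul_comm]
    · simp
  have e3 : ∑ i ∈ I, ∑ j ∈ J, m i j ≤ M := by
    calc ∑ i ∈ I, ∑ j ∈ J, m i j ≤ ∑ i ∈ I, ∑ j ∈ J, d / n :=
          Finset.sum_le_sum fun i _ => Finset.sum_le_sum fun j _ => hmd i j
      _ = M := by
          simp only [Finset.sum_const, nsmul_eq_mul]
          rw [hM]; ring
  have e4 := mul_le_mul_of_nonneg_left e3 (show 0 ≤ Real.exp L - 1 by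
    linarith [Real.one_le_exp hL0])
  rw [e2, h2]
  have e5 : (Real.exp L - 1) * M = τ - M := by rw [hexp]; field_simp
  linarith

/-- The function `E ↦ E log (E/e)`, with `e` here the local name for `exp 1 * M`, vanishes at `e`
and increases beyond it. So exceeding `t` forces `E` to exceed the point `τ ≥ e` where the value `t`
is taken, and `tail_edges` applies at `τ`. -/
lemma PoissonDominated.tail_discrepancy (h : PoissonDominated μ X m) {d : ℝ} (hd : 0 < d)
    (hmd : ∀ i j, m i j ≤ d / n) (hX : ∀ ω i j, 0 ≤ X ω i j) {I J : Finset (Fin n)}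
    (hI : I.Nonempty) (hJ : J.Nonempty) {t : ℝ} (ht : 0 < t) :
    μ.real {ω | t < (∑ i ∈ I, ∑ j ∈ J, X ω i j) * Real.log ((∑ i ∈ I, ∑ j ∈ J, X ω i j) /
      (Real.exp 1 * (d * I.card * J.card / n)))} ≤ Real.exp (-(1 / 2 * t)) := by
  have hn' : (0 : ℝ) < n := by
    obtain ⟨i, _⟩ := hI
    exact_mod_cast i.pos
  have hI' : (0 : ℝ) < I.card := by exact_mod_cast hI.card_pos
  have hJ' : (0 : ℝ) < J.card := by exact_mod_cast hJ.card_pos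
  set M := d * I.card * J.card / n with hM
  have hM0 : 0 < M := by positivity
  set e := Real.exp 1 * M with he
  have he0 : 0 < e := by positivity
  obtain ⟨τ, hτ, hτt⟩ : ∃ τ ∈ Set.Icc e (Real.exp 1 * e + t), τ * Real.log (τ / e) = t := by
    have hle : e ≤ Real.exp 1 * e + t := by
      nlinarith [Real.one_le_exp (zero_le_one (α := ℝ))]
    have hc : ContinuousOn (fun τ => τ * Real.log (τ / e)) (Set.Icc e (Real.exp 1 * e + t)) := by
      refine continuousOn_id.mul (ContinuousOn.log (continuousOn_id.div_const e) ?_)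
      intro τ hτ
      exact (div_pos (he0.trans_le hτ.1) he0).ne'
    refine intermediate_value_Icc hle hc ⟨?_, ?_⟩
    · simp only [div_self he0.ne', Real.log_one, mul_zero]; exact ht.le
    · have h1 : 1 ≤ Real.log ((Real.exp 1 * e + t) / e) := by
        rw [Real.le_log_iff_exp_le (by positivity), le_div_iff₀ he0]
        linarith
      have h2 : 0 < Real.exp 1 * e := by positivity
      have h3 := mul_le_mul_of_nonneg_left h1 (show 0 ≤ Real.exp 1 * e + t by positivity)
      linarith
  have hτ0 : 0 < τ := he0.trans_le hτ.1
  have hMe : M ≤ e := by nlinarith [Real.one_le_exp (zero_le_one (α := ℝ))]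
  have h1 := h.tail_edges hd hmd hI hJ (τ := τ) (hMe.trans hτ.1)
  rw [← hM, ← he, hτt] at h1
  refine le_trans (measureReal_mono fun ω hω => ?_) h1
  simp only [Set.mem_ofPred_eq] at hω ⊢
  set E := ∑ i ∈ I, ∑ j ∈ J, X ω i j
  have hE0 : 0 ≤ E := Finset.sum_nonneg fun i _ => Finset.sum_nonneg fun j _ => hX ω i j
  by_contra hlt
  push Not at hlt
  have hEpos : 0 < E := by
    refine hE0.lt_of_ne fun h0 => ?_
    rw [← h0, zero_mul] at hω
    linarith
  have h2 : Real.log (E / e) ≤ Real.log (τ / e) :=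
    Real.log_le_log (by positivity) (div_le_div_of_nonneg_right hlt.le he0.le)
  have h3 : 0 ≤ Real.log (τ / e) := Real.log_nonneg ((one_le_div he0).2 hτ.1)
  have h4 : E * Real.log (E / e) ≤ τ * Real.log (τ / e) :=
    (mul_le_mul_of_nonneg_left h2 hE0).trans (mul_le_mul_of_nonneg_right hlt.le h3)
  linarith

theorem PoissonDominated.boundedDiscrepancy (h : PoissonDominated μ X m) {d : ℝ} (hd : 0 < d)
    (hmd : ∀ i j, m i j ≤ d / n) (hX : ∀ ω i j, 0 ≤ X ω i j) {κ : ℝ} (hκ : 6 ≤ κ) :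
    μ.real {ω | ¬ BoundedDiscrepancy (X ω) d κ} ≤ Real.exp ((3 - κ / 2) * Real.log n) := by
  set P : Finset (Finset (Fin n) × Finset (Fin n)) :=
    Finset.univ.filter fun IJ => IJ.1.Nonempty ∧ IJ.1.card ≤ IJ.2.card with hP
  let B : Finset (Fin n) × Finset (Fin n) → Set Ω := fun IJ =>
    {ω | κ * setEntropy n IJ.2.card < (∑ i ∈ IJ.1, ∑ j ∈ IJ.2, X ω i j) *
      Real.log ((∑ i ∈ IJ.1, ∑ j ∈ IJ.2, X ω i j) /
      (Real.exp 1 * (d * IJ.1.card * IJ.2.card / n)))}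
  have hsub : {ω | ¬ BoundedDiscrepancy (X ω) d κ} ⊆ ⋃ IJ ∈ P, B IJ := by
    intro ω hω
    simp only [Set.mem_ofPred_eq, BoundedDiscrepancy, not_forall, not_le] at hω
    obtain ⟨I, J, hI, hIJ, hlt⟩ := hω
    simp only [Set.mem_iUnion]
    refine ⟨(I, J), by simp [hP, hI, hIJ], ?_⟩
    simp only [B, Set.mem_ofPred_eq, setEntropy, ← mul_assoc]
    exact hlt
  -- Of the exponent `κ/2` times the entropy, three units are kept for the union bound, one for the
  -- choice of `I` and two for `J`. The rest is turned into a power of `n` by `le_setEntropy`.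
  have hB : ∀ IJ ∈ P, μ.real (B IJ) ≤
      Real.exp ((3 - κ / 2) * Real.log n) * Real.exp (-3 * setEntropy n IJ.2.card) := by
    rintro ⟨I, J⟩ hIJ
    simp only [hP, Finset.mem_filter, Finset.mem_univ, true_and] at hIJ
    have hJ : J.Nonempty := Finset.card_pos.1 (hIJ.1.card_pos.trans_le hIJ.2)
    have hJn : J.card ≤ n := J.card_le_univ.trans (by simp)
    have hent := le_setEntropy hJ.card_pos hJn
    have hlog : 0 ≤ Real.log n := Real.log_natCast_nonneg n
    refine (h.tail_discrepancy hd hmd hX hIJ.1 hJ (mul_pos (by linarith) (by linarith))).trans ?_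
    rw [← Real.exp_add, Real.exp_le_exp]
    nlinarith
  have hsum : ∑ IJ ∈ P, Real.exp (-3 * setEntropy n IJ.2.card) ≤ 1 := by
    refine le_trans ?_ (sum_exp_neg_setEntropy_le n)
    rw [hP, Finset.sum_filter, Fintype.sum_prod_type_right, Finset.sum_filter]
    refine Finset.sum_le_sum fun J _ => ?_
    simp only
    by_cases hJ : J.Nonempty
    · rw [if_pos hJ, ← Finset.sum_filter, Finset.sum_const, nsmul_eq_mul]
      have hJn : J.card ≤ n := J.card_le_univ.trans (by simp)
      have hc : (((Finset.univ : Finset (Finset (Fin n))).filter fun I =>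
          I.Nonempty ∧ I.card ≤ J.card).card : ℝ) ≤ Real.exp (setEntropy n J.card) := by
        refine le_trans ?_ (card_filter_card_le_exp_setEntropy hJ.card_pos hJn)
        refine Nat.cast_le.2 (Finset.card_le_card fun I hI => ?_)
        simp only [Finset.mem_filter, Finset.mem_univ, true_and] at hI ⊢
        exact hI.2
      calc _ ≤ Real.exp (setEntropy n J.card) * Real.exp (-3 * setEntropy n J.card) :=
            mul_le_mul_of_nonneg_right hc (Real.exp_pos _).le
        _ = _ := by rw [← Real.exp_add]; congr 1; ring
    · rw [if_neg hJ]
      refine (Finset.sum_eq_zero fun I _ => if_neg fun hI => hJ ?_).le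
      exact Finset.card_pos.1 (hI.1.card_pos.trans_le hI.2)
  calc μ.real {ω | ¬ BoundedDiscrepancy (X ω) d κ} ≤ μ.real (⋃ IJ ∈ P, B IJ) :=
        measureReal_mono hsub (measure_ne_top _ _)
    _ ≤ ∑ IJ ∈ P, μ.real (B IJ) := measureReal_biUnion_finset_le P B
    _ ≤ ∑ IJ ∈ P, Real.exp ((3 - κ / 2) * Real.log n) * Real.exp (-3 * setEntropy n IJ.2.card) :=
        Finset.sum_le_sum hB
    _ = Real.exp ((3 - κ / 2) * Real.log n) * ∑ IJ ∈ P, Real.exp (-3 * setEntropy n IJ.2.card) := by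
        rw [Finset.mul_sum]
    _ ≤ _ := mul_le_of_le_one_right (Real.exp_pos _).le hsum

end Discrepancy

/-! ### Concentration of the matrix and of its degree vector. -/

section Concentration

variable {Ω : Type*} [MeasurableSpace Ω] {μ : Measure Ω} {n : ℕ}
  {X : Ω → Matrix (Fin n) (Fin n) ℝ} {m : Matrix (Fin n) (Fin n) ℝ}

lemma sum_ite_row_mul (i : Fin n) (l : ℝ) (Y : Fin n → Fin n → ℝ) :
    ∑ i', ∑ j, (if i' = i then l else 0) * Y i' j = l * ∑ j, Y i j := by
  rw [Finset.sum_eq_single i (fun b _ hb => by simp [hb]) (by simp)]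
  simp [Finset.mul_sum]

lemma sum_mul_exp_ite_row_sub_one (i : Fin n) (l : ℝ) (m : Matrix (Fin n) (Fin n) ℝ) :
    ∑ i', ∑ j, m i' j * (Real.exp (2 * if i' = i then l else 0) - 1) =
      (Real.exp (2 * l) - 1) * ∑ j, m i j := by
  rw [← sum_ite_row_mul i (Real.exp (2 * l) - 1) fun i j => m i j]
  refine Finset.sum_congr rfl fun i _ => Finset.sum_congr rfl fun j _ => ?_
  split_ifs
  · rw [mul_comm]
  · simp

lemma measureReal_exists_le {ι : Type*} (s : Finset ι) (B : ι → Set Ω) {c : ℝ}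
    (h : ∀ i ∈ s, μ.real (B i) ≤ c) : μ.real {ω | ∃ i ∈ s, ω ∈ B i} ≤ s.card * c := by
  have e : {ω | ∃ i ∈ s, ω ∈ B i} = ⋃ i ∈ s, B i := by ext ω; simp
  rw [e]
  refine (measureReal_biUnion_finset_le s B).trans ?_
  rw [← nsmul_eq_mul]
  exact Finset.sum_le_card_nsmul _ _ _ h

lemma PoissonDominated.tail_row_upper (h : PoissonDominated μ X m) {M κ : ℝ}
    (hm : ∀ i j, 0 ≤ m i j) (hM : ∀ i, ∑ j, m i j ≤ M) :
    μ.real {ω | ∃ i, κ * M ≤ ∑ j, X ω i j} ≤ n * Real.exp ((1 - κ / 2) * M) := by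
  have h1 := measureReal_exists_le (μ := μ) Finset.univ
    (fun i : Fin n => {ω | κ * M ≤ ∑ j, X ω i j}) (c := Real.exp ((1 - κ / 2) * M)) (by
    intro i _
    have h1 := h.tail (fun i' j => if i' = i then 1 / 2 else 0) (1 / 2 * (κ * M))
    simp only [sum_ite_row_mul i (1 / 2) fun i j => X _ i j, sum_mul_exp_ite_row_sub_one] at h1
    have e : {ω | 1 / 2 * (κ * M) ≤ 1 / 2 * ∑ j, X ω i j} = {ω | κ * M ≤ ∑ j, X ω i j} := by
      ext ω
      rw [Set.mem_ofPred_eq, Set.mem_ofPred_eq]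
      constructor <;> intro h <;> linarith
    rw [e] at h1
    refine h1.trans (Real.exp_le_exp.2 ?_)
    have h2 : Real.exp (2 * (1 / 2)) ≤ 3 := by
      norm_num; linarith [Real.exp_one_lt_d9]
    have h0 : 0 ≤ ∑ j, m i j := Finset.sum_nonneg fun j _ => hm i j
    nlinarith [hM i])
  simpa using h1

lemma PoissonDominated.tail_row_lower (h : PoissonDominated μ X m) {D : ℝ} (hD0 : 0 ≤ D)
    (hD : ∀ i, D ≤ ∑ j, m i j) :
    μ.real {ω | ∃ i, ∑ j, X ω i j ≤ (∑ j, m i j) / 16} ≤ n * Real.exp (-(3 / 8 * D)) := by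
  have h1 := measureReal_exists_le (μ := μ) Finset.univ
    (fun i : Fin n => {ω | ∑ j, X ω i j ≤ (∑ j, m i j) / 16}) (c := Real.exp (-(3 / 8 * D))) (by
    intro i _
    -- This weight makes `exp (2w) = 1/16`, the optimal tilt for the threshold `1/16`. The rate
    -- `15/32 - (log 2)/8` exceeds `3/8`, the value later compared with the third error term.
    have h1 := h.tail (fun i' j => if i' = i then -(2 * Real.log 2) else 0)
      (-(2 * Real.log 2) * ((∑ j, m i j) / 16))
    simp only [sum_ite_row_mul i (-(2 * Real.log 2)) fun i j => X _ i j,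
      sum_mul_exp_ite_row_sub_one] at h1
    have hl : 0 < Real.log 2 := Real.log_pos one_lt_two
    have e : {ω | -(2 * Real.log 2) * ((∑ j, m i j) / 16) ≤ -(2 * Real.log 2) * ∑ j, X ω i j} =
        {ω | ∑ j, X ω i j ≤ (∑ j, m i j) / 16} := by
      ext ω
      rw [Set.mem_ofPred_eq, Set.mem_ofPred_eq]
      exact mul_le_mul_left_of_neg (by linarith)
    rw [e] at h1
    refine h1.trans (Real.exp_le_exp.2 ?_)
    have h2 : Real.exp (2 * -(2 * Real.log 2)) = 1 / 16 := by
      rw [show 2 * -(2 * Real.log 2) = -((4 : ℕ) * Real.log 2) by push_cast; ring, Real.exp_neg,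
        Real.exp_nat_mul, Real.exp_log two_pos]
      norm_num
    rw [h2]
    have h3 := hD i
    have h4 := Real.log_two_lt_d9
    nlinarith)
  simpa using h1

/-- The contribution to the bilinear form of the pairs whose coefficient is at most `q / n`. -/
lemma PoissonDominated.tail_light (h : PoissonDominated μ X m) (hm : ∀ i j, 0 ≤ m i j) {q κ : ℝ}
    (hq : 0 < q) (hn : 0 < n) (hmq : ∀ i j, m i j ≤ q ^ 2 / n) {x y : Fin n → ℝ}
    (hx : ∑ i, x i ^ 2 ≤ 2) (hy : ∑ i, y i ^ 2 ≤ 2) :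
    μ.real {ω | 2 * κ * q ≤ ∑ i, ∑ j,
      (if q / n < |x i * y j| then 0 else x i * y j) * (X ω i j - m i j)} ≤
      Real.exp ((2 - κ) * n) := by
  have hn' : (0 : ℝ) < n := by exact_mod_cast hn
  set w : Fin n → Fin n → ℝ := fun i j => if q / n < |x i * y j| then 0 else x i * y j with hw
  have hwabs : ∀ i j, |w i j| ≤ q / n := by
    intro i j
    simp only [hw]
    split_ifs with hc
    · rw [abs_zero]; positivity
    · exact not_lt.1 hc
  have hwsq : ∀ i j, w i j ^ 2 ≤ x i ^ 2 * y j ^ 2 := by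
    intro i j
    simp only [hw]
    split_ifs with hc
    · rw [← mul_pow, zero_pow two_ne_zero]; exact sq_nonneg _
    · rw [mul_pow]
  have hs : 0 < n / (2 * q) := by positivity
  -- The truncation at `q/n` lets the weights be scaled by `n/(2q)` and stay within `1/2`. Since `m
  -- i j ≤ q²/n`, the variance term then costs at most `2n`.
  have h1 := h.tail_sub hm (fun i j => n / (2 * q) * w i j) (fun i j => by
    rw [abs_mul, abs_of_pos hs]
    calc n / (2 * q) * |w i j| ≤ n / (2 * q) * (q / n) :=
          mul_le_mul_of_nonneg_left (hwabs i j) hs.le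
      _ = 1 / 2 := by field_simp) (κ * n)
  have e : {ω | κ * n ≤ ∑ i, ∑ j, n / (2 * q) * w i j * (X ω i j - m i j)} =
      {ω | 2 * κ * q ≤ ∑ i, ∑ j, w i j * (X ω i j - m i j)} := by
    ext ω
    rw [Set.mem_ofPred_eq, Set.mem_ofPred_eq]
    simp only [mul_assoc (n / (2 * q) : ℝ), ← Finset.mul_sum]
    rw [show κ * n = n / (2 * q) * (2 * κ * q) by field_simp]
    exact mul_le_mul_iff_right₀ hs
  rw [e] at h1
  refine h1.trans (Real.exp_le_exp.2 ?_)
  have h2 : ∑ i, ∑ j, m i j * (n / (2 * q) * w i j) ^ 2 ≤ (n : ℝ) := by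
    calc ∑ i, ∑ j, m i j * (n / (2 * q) * w i j) ^ 2
        ≤ ∑ i, ∑ j, n / 4 * (x i ^ 2 * y j ^ 2) := by
          refine Finset.sum_le_sum fun i _ => Finset.sum_le_sum fun j _ => ?_
          calc m i j * (n / (2 * q) * w i j) ^ 2 ≤ q ^ 2 / n * (n / (2 * q) * w i j) ^ 2 :=
                mul_le_mul_of_nonneg_right (hmq i j) (sq_nonneg _)
            _ = n / 4 * w i j ^ 2 := by field_simp; ring
            _ ≤ _ := mul_le_mul_of_nonneg_left (hwsq i j) (by positivity)
      _ = n / 4 * ((∑ i, x i ^ 2) * ∑ j, y j ^ 2) := by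
          rw [Finset.sum_mul_sum, Finset.mul_sum]
          exact Finset.sum_congr rfl fun i _ => (Finset.mul_sum _ _ _).symm
      _ ≤ n / 4 * (2 * 2) := by
          refine mul_le_mul_of_nonneg_left (mul_le_mul hx hy ?_ (by norm_num)) (by positivity)
          exact Finset.sum_nonneg fun _ _ => sq_nonneg _
      _ = n := by ring
  linarith

/-- Pairing the degree deviations with `x` uses weights that are constant along rows, so the
variance involves the row sums `M` of `m`. This gives the scale `√(nM)`, where passing through the
spectral norm would give `q√n`. -/
lemma PoissonDominated.tail_light_row (h : PoissonDominated μ X m) (hm : ∀ i j, 0 ≤ m i j)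
    {M κ : ℝ} (hM0 : 0 < M) (hn : 0 < n) (hM : ∀ i, ∑ j, m i j ≤ M) {x : Fin n → ℝ}
    (hx : ∑ i, x i ^ 2 ≤ 2) :
    μ.real {ω | 2 * κ * √(n * M) ≤ ∑ i,
      (if √(M / n) < |x i| then 0 else x i) * ∑ j, (X ω i j - m i j)} ≤
      Real.exp ((2 - κ) * n) := by
  have hn' : (0 : ℝ) < n := by exact_mod_cast hn
  set θ := √(M / n) with hθ
  have hθ0 : 0 < θ := Real.sqrt_pos.2 (by positivity)
  have hθ2 : θ ^ 2 = M / n := Real.sq_sqrt (by positivity)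
  have hnM : √(n * M) = n * θ := by
    rw [Real.sqrt_eq_iff_mul_self_eq (by positivity) (by positivity)]
    rw [show (n * θ) * (n * θ) = n ^ 2 * θ ^ 2 by ring, hθ2]
    field_simp
  set w : Fin n → ℝ := fun i => if θ < |x i| then 0 else x i with hw
  have hwabs : ∀ i, |w i| ≤ θ := by
    intro i
    simp only [hw]
    split_ifs with hc
    · rw [abs_zero]; exact hθ0.le
    · exact not_lt.1 hc
  have hwsq : ∀ i, w i ^ 2 ≤ x i ^ 2 := by
    intro i
    simp only [hw]
    split_ifs with hc
    · rw [zero_pow two_ne_zero]; exact sq_nonneg _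
    · exact le_rfl
  have hs : 0 < 1 / (2 * θ) := by positivity
  have h1 := h.tail_sub hm (fun i _ => 1 / (2 * θ) * w i) (fun i j => by
    rw [abs_mul, abs_of_pos hs]
    calc 1 / (2 * θ) * |w i| ≤ 1 / (2 * θ) * θ := mul_le_mul_of_nonneg_left (hwabs i) hs.le
      _ = 1 / 2 := by field_simp) (κ * n)
  have e : {ω | κ * n ≤ ∑ i, ∑ j, 1 / (2 * θ) * w i * (X ω i j - m i j)} =
      {ω | 2 * κ * √(n * M) ≤ ∑ i, w i * ∑ j, (X ω i j - m i j)} := by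
    ext ω
    rw [Set.mem_ofPred_eq, Set.mem_ofPred_eq]
    simp only [mul_assoc (1 / (2 * θ) : ℝ), ← Finset.mul_sum]
    rw [show κ * n = 1 / (2 * θ) * (2 * κ * √(n * M)) by rw [hnM]; field_simp]
    exact mul_le_mul_iff_right₀ hs
  rw [e] at h1
  refine h1.trans (Real.exp_le_exp.2 ?_)
  have h2 : ∑ i, ∑ j, m i j * (1 / (2 * θ) * w i) ^ 2 ≤ (n : ℝ) / 2 := by
    calc ∑ i, ∑ j, m i j * (1 / (2 * θ) * w i) ^ 2
        = ∑ i, (∑ j, m i j) * (1 / (2 * θ) * w i) ^ 2 := by simp only [Finset.sum_mul]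
      _ ≤ ∑ i, n / 4 * x i ^ 2 := by
          refine Finset.sum_le_sum fun i _ => ?_
          calc (∑ j, m i j) * (1 / (2 * θ) * w i) ^ 2 ≤ M * (1 / (2 * θ) * w i) ^ 2 :=
                mul_le_mul_of_nonneg_right (hM i) (sq_nonneg _)
            _ = n / 4 * w i ^ 2 := by
                rw [mul_pow, div_pow, mul_pow, hθ2]; field_simp; ring
            _ ≤ _ := mul_le_mul_of_nonneg_left (hwsq i) (by positivity)
      _ = n / 4 * ∑ i, x i ^ 2 := by rw [Finset.mul_sum]
      _ ≤ n / 4 * 2 := mul_le_mul_of_nonneg_left hx (by positivity)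
      _ = n / 2 := by ring
  nlinarith

/-- Heavy coordinates contribute little to the pairing with a bounded vector. -/
lemma sum_heavy_row_le {n : ℕ} (hn : 0 < n) {M κ : ℝ} (hM0 : 0 < M) (hκ : 0 ≤ κ) {x g : Fin n → ℝ}
    (hx : ∑ i, x i ^ 2 ≤ 2) (hg : ∀ i, |g i| ≤ κ * M) :
    ∑ i, (if √(M / n) < |x i| then x i else 0) * g i ≤ 2 * κ * √(n * M) := by
  have hn' : (0 : ℝ) < n := by exact_mod_cast hn
  set θ := √(M / n) with hθ
  have hθ0 : 0 < θ := Real.sqrt_pos.2 (by positivity)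
  have hθ2 : θ ^ 2 = M / n := Real.sq_sqrt (by positivity)
  have hnM : √(n * M) = n * θ := by
    rw [Real.sqrt_eq_iff_mul_self_eq (by positivity) (by positivity)]
    rw [show (n * θ) * (n * θ) = n ^ 2 * θ ^ 2 by ring, hθ2]
    field_simp
  have hκM : 0 ≤ κ * M := by positivity
  calc ∑ i, (if θ < |x i| then x i else 0) * g i ≤ ∑ i, x i ^ 2 / θ * (κ * M) := by
        refine Finset.sum_le_sum fun i _ => ?_
        split_ifs with hc
        · have h1 : |x i| ≤ x i ^ 2 / θ := by
            rw [le_div_iff₀ hθ0, ← sq_abs]; nlinarith [abs_nonneg (x i)]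
          calc x i * g i ≤ |x i| * |g i| := by rw [← abs_mul]; exact le_abs_self _
            _ ≤ _ := mul_le_mul h1 (hg i) (abs_nonneg _) (by positivity)
        · rw [zero_mul]; positivity
    _ = (∑ i, x i ^ 2) * (κ * M / θ) := by
        rw [Finset.sum_mul]; exact Finset.sum_congr rfl fun i _ => by ring
    _ ≤ 2 * (κ * M / θ) := mul_le_mul_of_nonneg_right hx (by positivity)
    _ = 2 * κ * √(n * M) := by
        rw [hnM, show M = n * θ ^ 2 by rw [hθ2]; field_simp]; field_simp

/-- On the event that the rows are bounded and the discrepancy is bounded, the bilinear form at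
two grid vectors is controlled by its light part. -/
lemma bilin_le_of_light {n : ℕ} (hn : 0 < n) {Y m : Matrix (Fin n) (Fin n) ℝ} {q κ : ℝ}
    (hY : ∀ i j, 0 ≤ Y i j) (hsymm : ∀ i j, Y j i = Y i j) (hm : ∀ i j, 0 ≤ m i j)
    (hmq : ∀ i j, m i j ≤ q ^ 2 / n) (hq : 0 < q) (hκ : 1 ≤ κ)
    (hdeg : ∀ i, ∑ j, Y i j ≤ κ * q ^ 2) (hdisc : BoundedDiscrepancy Y (q ^ 2) κ)
    {x y : Fin n → ℝ} (hx : ∑ i, x i ^ 2 ≤ 2) (hy : ∑ i, y i ^ 2 ≤ 2)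
    (hlight : ∑ i, ∑ j, (if q / n < |x i * y j| then 0 else x i * y j) * (Y i j - m i j) ≤
      2 * κ * q) :
    ∑ i, ∑ j, x i * y j * (Y i j - m i j) ≤ 120006 * κ * q := by
  have hn' : (0 : ℝ) < n := by exact_mod_cast hn
  have h1 := sum_heavy_le hn hY hsymm hq hκ hdeg hdisc hx hy
  have h2 : ∑ i, ∑ j, q * (x i ^ 2 * y j ^ 2) ≤ 4 * q := by
    calc ∑ i, ∑ j, q * (x i ^ 2 * y j ^ 2) = q * ((∑ i, x i ^ 2) * ∑ j, y j ^ 2) := by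
          rw [Finset.sum_mul_sum, Finset.mul_sum]
          exact Finset.sum_congr rfl fun i _ => (Finset.mul_sum _ _ _).symm
      _ ≤ q * (2 * 2) := by
          refine mul_le_mul_of_nonneg_left (mul_le_mul hx hy ?_ (by norm_num)) hq.le
          exact Finset.sum_nonneg fun _ _ => sq_nonneg _
      _ = 4 * q := by ring
  have h3 := add_le_add (add_le_add hlight h1) h2
  simp only [← Finset.sum_add_distrib] at h3
  refine le_trans (Finset.sum_le_sum fun i _ => Finset.sum_le_sum fun j _ => ?_)
    (h3.trans (by nlinarith))
  have hsq : 0 ≤ q * (x i ^ 2 * y j ^ 2) := by positivity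
  split_ifs with hc
  -- For a heavy pair `q/n < |x_i y_j|`, so the mean contributes at most `q (x_i y_j)²`, which sums
  -- to at most `4q`.
  · have h4 : |x i * y j| * m i j ≤ q * (x i ^ 2 * y j ^ 2) := by
      rw [← mul_pow, ← sq_abs]
      have h5 : |x i * y j| * m i j ≤ |x i * y j| * (q ^ 2 / n) :=
        mul_le_mul_of_nonneg_left (hmq i j) (abs_nonneg _)
      have h6 : |x i * y j| * (q ^ 2 / n) = q * (|x i * y j| * (q / n)) := by ring
      rw [h6] at h5
      refine h5.trans (mul_le_mul_of_nonneg_left ?_ hq.le)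
      rw [sq]
      exact mul_le_mul_of_nonneg_left hc.le (abs_nonneg _)
    have h7 : x i * y j * Y i j ≤ |x i * y j| * Y i j :=
      mul_le_mul_of_nonneg_right (le_abs_self _) (hY i j)
    have h8 : -(x i * y j) * m i j ≤ |x i * y j| * m i j :=
      mul_le_mul_of_nonneg_right (neg_le_abs _) (hm i j)
    linarith
  · linarith

/-- Concentration in spectral norm, and of the vector of degrees, of a symmetric matrix with Poisson
dominated entries. -/
theorem PoissonDominated.concentration [IsProbabilityMeasure μ] (h : PoissonDominated μ X m) (hn : 0 < n)
    (hX : ∀ ω i j, 0 ≤ X ω i j) (hsymm : ∀ ω i j, X ω j i = X ω i j) (hm : ∀ i j, 0 ≤ m i j)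
    {q M κ : ℝ} (hq : 0 < q) (hmq : ∀ i j, m i j ≤ q ^ 2 / n) (hM0 : 0 < M)
    (hM : ∀ i, ∑ j, m i j ≤ M) (hMq : M ≤ q ^ 2) (hlog : Real.log n ≤ M) (hκ : 112 ≤ κ) :
    μ.real {ω | ¬ (matrixSpectralNorm (X ω - m) ≤ 400000 * κ * q ∧
      ∑ i, (∑ j, (X ω i j - m i j)) ^ 2 ≤ 64 * κ ^ 2 * (n * M))} ≤
      4 * Real.exp ((3 - κ / 2) * Real.log n) := by
  have hn' : (0 : ℝ) < n := by exact_mod_cast hn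
  have hlog0 : 0 ≤ Real.log n := Real.log_natCast_nonneg n
  have hlogn : Real.log n ≤ n := (Real.log_le_sub_one_of_pos hn').trans (by linarith)
  set E1 : Set Ω := {ω | ∃ i, κ * M ≤ ∑ j, X ω i j} with hE1
  set E2 : Set Ω := {ω | ¬ BoundedDiscrepancy (X ω) (q ^ 2) κ} with hE2
  set E3 : Set Ω := {ω | ∃ zz ∈ gridPoints n ×ˢ gridPoints n, ω ∈ {ω | 2 * κ * q ≤ ∑ i, ∑ j,
      (if q / n < |gridVec zz.1 i * gridVec zz.2 j| then 0 else gridVec zz.1 i * gridVec zz.2 j) *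
        (X ω i j - m i j)}} with hE3
  set E4 : Set Ω := {ω | ∃ z ∈ gridPoints n, ω ∈ {ω | 2 * κ * √(n * M) ≤ ∑ i,
      (if √(M / n) < |gridVec z i| then 0 else gridVec z i) * ∑ j, (X ω i j - m i j)}} with hE4
  have hgrid : ∀ z ∈ gridPoints n, ∑ i, gridVec z i ^ 2 ≤ 2 := fun z hz =>
    (sum_gridVec_sq_le hn hz).trans (by norm_num)
  have p1 : μ.real E1 ≤ Real.exp ((3 - κ / 2) * Real.log n) := by
    refine (h.tail_row_upper hm hM).trans ?_
    rw [← Real.exp_log hn', ← Real.exp_add, Real.exp_le_exp, Real.exp_log hn']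
    nlinarith
  have p2 : μ.real E2 ≤ Real.exp ((3 - κ / 2) * Real.log n) :=
    h.boundedDiscrepancy (by positivity) hmq hX (by linarith)
  have p3 : μ.real E3 ≤ Real.exp ((3 - κ / 2) * Real.log n) := by
    refine (measureReal_exists_le (gridPoints n ×ˢ gridPoints n) _ fun zz hzz =>
      h.tail_light hm hq hn hmq (hgrid _ (Finset.mem_product.1 hzz).1)
        (hgrid _ (Finset.mem_product.1 hzz).2)).trans ?_
    rw [Finset.card_product]
    push_cast
    have hc := card_gridPoints_le n
    calc ((gridPoints n).card : ℝ) * (gridPoints n).card * Real.exp ((2 - κ) * n)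
        ≤ Real.exp (27 * n) * Real.exp (27 * n) * Real.exp ((2 - κ) * n) := by gcongr
      _ = Real.exp ((56 - κ) * n) := by rw [← Real.exp_add, ← Real.exp_add]; congr 1; ring
      -- Two grid vectors cost `54n`. The hypothesis `112 = 2 · 56` makes `56 - κ ≤ -κ/2`, and `log
      -- n ≤ n` then gives the common power of `n`.
      _ ≤ _ := Real.exp_le_exp.2 (by nlinarith)
  have p4 : μ.real E4 ≤ Real.exp ((3 - κ / 2) * Real.log n) := by
    refine (measureReal_exists_le (gridPoints n) _ fun z hz =>
      h.tail_light_row hm hM0 hn hM (hgrid _ hz)).trans ?_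
    have hc := card_gridPoints_le n
    calc ((gridPoints n).card : ℝ) * Real.exp ((2 - κ) * n)
        ≤ Real.exp (27 * n) * Real.exp ((2 - κ) * n) := by gcongr
      _ = Real.exp ((29 - κ) * n) := by rw [← Real.exp_add]; congr 1; ring
      _ ≤ _ := Real.exp_le_exp.2 (by nlinarith)
  have hsub : {ω | ¬ (matrixSpectralNorm (X ω - m) ≤ 400000 * κ * q ∧
      ∑ i, (∑ j, (X ω i j - m i j)) ^ 2 ≤ 64 * κ ^ 2 * (n * M))} ⊆ (E1 ∪ E2) ∪ (E3 ∪ E4) := by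
    intro ω hω
    by_contra hnot
    simp only [Set.mem_union, not_or] at hnot
    obtain ⟨⟨h1, h2⟩, h3, h4⟩ := hnot
    refine hω ?_
    have h1' : ∀ i, ∑ j, X ω i j ≤ κ * M := by
      intro i
      by_contra hc
      exact h1 ⟨i, (not_le.1 hc).le⟩
    have h2' : BoundedDiscrepancy (X ω) (q ^ 2) κ := not_not.1 h2
    constructor
    · have hnorm := matrixSpectralNorm_le_of_grid hn (X ω - m) (B := 120006 * κ * q)
        (by positivity) fun z hz z' hz' => by
          refine bilin_le_of_light hn (hX ω) (hsymm ω) hm hmq hq (by linarith)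
            (fun i => (h1' i).trans ?_) h2' (hgrid z hz) (hgrid z' hz') ?_
          · exact mul_le_mul_of_nonneg_left hMq (by linarith)
          · by_contra hc
            exact h3 ⟨(z, z'), Finset.mem_product.2 ⟨hz, hz'⟩, (not_le.1 hc).le⟩
      refine hnorm.trans ?_
      have : 0 ≤ κ * q := by positivity
      nlinarith
    · have hg : ∀ i, |∑ j, (X ω i j - m i j)| ≤ κ * M := by
        intro i
        have a1 : 0 ≤ ∑ j, X ω i j := Finset.sum_nonneg fun j _ => hX ω i j
        have a2 : 0 ≤ ∑ j, m i j := Finset.sum_nonneg fun j _ => hm i j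
        rw [Finset.sum_sub_distrib, abs_le]
        have a3 := h1' i
        have a4 := hM i
        constructor <;> nlinarith
      have hsq := sum_sq_le_of_grid hn (g := fun i => ∑ j, (X ω i j - m i j))
        (B := 4 * κ * √(n * M)) fun z hz => by
          have b1 := sum_heavy_row_le hn hM0 (by linarith) (hgrid z hz) hg
          have b2 : ∑ i, (if √(M / n) < |gridVec z i| then 0 else gridVec z i) *
              ∑ j, (X ω i j - m i j) ≤ 2 * κ * √(n * M) := by
            by_contra hc
            exact h4 ⟨z, hz, (not_le.1 hc).le⟩
          have b3 : ∑ i, gridVec z i * ∑ j, (X ω i j - m i j) =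
              ∑ i, (if √(M / n) < |gridVec z i| then gridVec z i else 0) *
                ∑ j, (X ω i j - m i j) +
              ∑ i, (if √(M / n) < |gridVec z i| then 0 else gridVec z i) *
                ∑ j, (X ω i j - m i j) := by
            rw [← Finset.sum_add_distrib]
            refine Finset.sum_congr rfl fun i _ => ?_
            split_ifs <;> simp
          rw [b3]; linarith
      refine hsq.trans (le_of_eq ?_)
      rw [show (2 * (4 * κ * √(n * M))) ^ 2 = 64 * κ ^ 2 * √(n * M) ^ 2 by ring,
        Real.sq_sqrt (by positivity)]
  refine (measureReal_mono hsub (measure_ne_top _ _)).trans ?_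
  have u1 := measureReal_union_le (μ := μ) (E1 ∪ E2) (E3 ∪ E4)
  have u2 := measureReal_union_le (μ := μ) E1 E2
  have u3 := measureReal_union_le (μ := μ) E3 E4
  linarith

end Concentration

/-! ### Perturbation of the normalized Laplacian. -/

section Laplacian

open scoped Matrix.Norms.L2Operator

lemma matrixSpectralNorm_eq_norm {n : ℕ} (M : Matrix (Fin n) (Fin n) ℝ) :
    matrixSpectralNorm M = ‖M‖ :=
  Matrix.l2_opNorm_toEuclideanCLM M

lemma l2_opNorm_le_sqrt_sum_sq {n : ℕ} (M : Matrix (Fin n) (Fin n) ℝ) :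
    ‖M‖ ≤ √(∑ i, ∑ j, M i j ^ 2) := by
  rw [← matrixSpectralNorm_eq_norm, matrixSpectralNorm]
  refine ContinuousLinearMap.opNorm_le_bound _ (Real.sqrt_nonneg _) fun x => ?_
  have h0 : 0 ≤ ∑ i, ∑ j, M i j ^ 2 :=
    Finset.sum_nonneg fun i _ => Finset.sum_nonneg fun j _ => sq_nonneg _
  refine le_of_sq_le_sq ?_ (by positivity)
  rw [mul_pow, Real.sq_sqrt h0, EuclideanSpace.real_norm_sq_eq, EuclideanSpace.real_norm_sq_eq,
    Finset.sum_mul]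
  refine Finset.sum_le_sum fun i _ => ?_
  exact Finset.sum_mul_sq_le_sq_mul_sq Finset.univ (M i) x

/-- With `u = √d` and `v = √e`, the assumption on `e` says `u ≤ 4v`, so `δ ≤ u² ≤ 4uv`, and `|v - u|
u` is at most `|v² - u²|`. -/
lemma abs_sqrt_div_sqrt_sub_one_mul_le {d e δ : ℝ} (hδ : 0 < δ) (hd : δ ≤ d) (he : d / 16 ≤ e) :
    |√d / √e - 1| * δ ≤ 4 * |e - d| := by
  have hd0 : 0 < d := hδ.trans_le hd
  have he0 : 0 < e := by linarith
  set u := √d with hu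
  set v := √e with hv
  have hu0 : 0 < u := Real.sqrt_pos.2 hd0
  have hv0 : 0 < v := Real.sqrt_pos.2 he0
  have hu2 : u ^ 2 = d := Real.sq_sqrt hd0.le
  have hv2 : v ^ 2 = e := Real.sq_sqrt he0.le
  have huv : u ≤ 4 * v := by
    refine le_of_sq_le_sq ?_ (by positivity)
    rw [mul_pow, hu2, hv2]; linarith
  have h1 : |u / v - 1| = |v - u| / v := by
    rw [div_sub_one hv0.ne', abs_div, abs_of_pos hv0, abs_sub_comm]
  have h2 : |e - d| = |v - u| * (v + u) := by
    rw [← hu2, ← hv2, show v ^ 2 - u ^ 2 = (v - u) * (v + u) by ring, abs_mul,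
      abs_of_pos (show 0 < v + u by linarith)]
  rw [h1, h2]
  calc |v - u| / v * δ ≤ |v - u| / v * (u * (4 * v)) := by
        refine mul_le_mul_of_nonneg_left ?_ (by positivity)
        nlinarith
    _ = 4 * (|v - u| * u) := by field_simp
    _ ≤ 4 * (|v - u| * (v + u)) := by
        have := mul_le_mul_of_nonneg_left (show u ≤ v + u by linarith) (abs_nonneg (v - u))
        linarith

/-- Perturbation of the normalized Laplacian: it is controlled by the perturbation of the matrix in
spectral norm and by that of the degrees in Euclidean norm. -/
theorem matrixSpectralNorm_normalizedLaplacian_sub_le {n : ℕ} {A P : Matrix (Fin n) (Fin n) ℝ}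
    {α δ : ℝ} (hP0 : ∀ i j, 0 ≤ P i j) (hPα : ∀ i j, P i j ≤ α) (hsymm : ∀ i j, P j i = P i j)
    (hδ : 0 < δ) (hdP : ∀ i, δ ≤ rowDegree P i) (hdA : ∀ i, rowDegree P i / 16 ≤ rowDegree A i) :
    matrixSpectralNorm (normalizedLaplacian A - normalizedLaplacian P) ≤
      16 / δ * matrixSpectralNorm (A - P) +
        20 / δ * √(α / δ * ∑ i, (rowDegree A i - rowDegree P i) ^ 2) := by
  simp only [matrixSpectralNorm_eq_norm]
  have hP : ∀ i, 0 < rowDegree P i := fun i => hδ.trans_le (hdP i)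
  have hA : ∀ i, 0 < rowDegree A i := fun i => by linarith [hP i, hdA i]
  have hsP : ∀ i, 0 < √(rowDegree P i) := fun i => Real.sqrt_pos.2 (hP i)
  have hsA : ∀ i, 0 < √(rowDegree A i) := fun i => Real.sqrt_pos.2 (hA i)
  set a : Fin n → ℝ := fun i => (√(rowDegree A i))⁻¹ with ha
  set s : Fin n → ℝ := fun i => √(rowDegree P i) / √(rowDegree A i) with hs
  set L := normalizedLaplacian P with hL
  have hLij : ∀ i j, L i j = (√(rowDegree P i))⁻¹ * P i j * (√(rowDegree P j))⁻¹ := by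
    intro i j
    rw [hL, normalizedLaplacian, Matrix.mul_diagonal, Matrix.diagonal_mul]
  set E : Matrix (Fin n) (Fin n) ℝ := Matrix.of fun i j => (s i - 1) * L i j with hE
  -- With `S = diag s`, `SLS - L = (S - 1)LS + L(S - 1)`, and the last term is the transpose of `E =
  -- (S - 1)L` because `L` is symmetric. As `‖S‖ ≤ 4`, both together cost `5‖E‖`.
  have hdecomp : normalizedLaplacian A - L =
      Matrix.diagonal a * (A - P) * Matrix.diagonal a + (E * Matrix.diagonal s + E.transpose) := by
    ext i j
    have e1 : L j i = L i j := by rw [hLij, hLij, hsymm i j]; ring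
    simp only [normalizedLaplacian, Matrix.sub_apply, Matrix.add_apply, Matrix.mul_diagonal,
      Matrix.diagonal_mul, Matrix.transpose_apply, hE, Matrix.of_apply, e1]
    have e2 : s i * L i j * s j = a i * P i j * a j := by
      rw [hLij]
      simp only [hs, ha]
      have h1 := (hsP i).ne'
      have h2 := (hsP j).ne'
      field_simp
    linear_combination -e2
  have hEF : ‖E‖ ≤ 4 / δ * √(α / δ * ∑ i, (rowDegree A i - rowDegree P i) ^ 2) := by
    refine (l2_opNorm_le_sqrt_sum_sq E).trans ?_
    have h4 : (4 / δ : ℝ) = √((4 / δ) ^ 2) := (Real.sqrt_sq (by positivity)).symm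
    rw [h4, ← Real.sqrt_mul (by positivity)]
    refine Real.sqrt_le_sqrt ?_
    rw [Finset.mul_sum, Finset.mul_sum]
    refine Finset.sum_le_sum fun i _ => ?_
    -- Rows of `L` are flat: one factor `P i j ≤ α` is spent against a degree `≥ δ`, and the other
    -- sums to the degree of `i`. This makes the Frobenius norm of `E` small.
    have hrow : ∑ j, L i j ^ 2 ≤ α / δ := by
      have hij : ∀ j, L i j ^ 2 ≤ α / δ * (P i j / rowDegree P i) := by
        intro j
        rw [hLij, mul_pow, mul_pow, inv_pow, inv_pow, Real.sq_sqrt (hP i).le,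
          Real.sq_sqrt (hP j).le]
        have h1 : P i j ^ 2 ≤ α * P i j := by
          rw [sq]; exact mul_le_mul_of_nonneg_right (hPα i j) (hP0 i j)
        have h2 : (rowDegree P j)⁻¹ ≤ δ⁻¹ := inv_anti₀ hδ (hdP j)
        have h3 : 0 < (rowDegree P i)⁻¹ := inv_pos.2 (hP i)
        have h5 : 0 ≤ α * P i j := (sq_nonneg _).trans h1
        calc (rowDegree P i)⁻¹ * P i j ^ 2 * (rowDegree P j)⁻¹
            ≤ (rowDegree P i)⁻¹ * (α * P i j) * δ⁻¹ := by
              refine mul_le_mul (mul_le_mul_of_nonneg_left h1 h3.le) h2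
                (inv_pos.2 (hP j)).le (mul_nonneg h3.le h5)
          _ = _ := by rw [div_eq_mul_inv, div_eq_mul_inv]; ring
      refine (Finset.sum_le_sum fun j _ => hij j).trans (le_of_eq ?_)
      rw [← Finset.mul_sum, ← Finset.sum_div]
      rw [show ∑ j, P i j = rowDegree P i from rfl, div_self (hP i).ne', mul_one]
    have hs1 : (s i - 1) ^ 2 ≤ (4 / δ) ^ 2 * (rowDegree A i - rowDegree P i) ^ 2 := by
      have := abs_sqrt_div_sqrt_sub_one_mul_le hδ (hdP i) (hdA i)
      rw [← mul_pow, ← sq_abs, ← sq_abs (4 / δ * _)]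
      refine pow_le_pow_left₀ (abs_nonneg _) ?_ 2
      rw [abs_mul, abs_of_pos (show 0 < 4 / δ by positivity), div_mul_eq_mul_div,
        le_div_iff₀ hδ]
      exact this
    calc ∑ j, E i j ^ 2 = (s i - 1) ^ 2 * ∑ j, L i j ^ 2 := by
          simp only [hE, Matrix.of_apply, mul_pow, Finset.mul_sum]
      _ ≤ (4 / δ) ^ 2 * (rowDegree A i - rowDegree P i) ^ 2 * (α / δ) :=
          mul_le_mul hs1 hrow (Finset.sum_nonneg fun _ _ => sq_nonneg _) (by positivity)
      _ = _ := by ring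
  have hEt : ‖E.transpose‖ = ‖E‖ := by
    rw [← Matrix.l2_opNorm_conjTranspose E, Matrix.conjTranspose_eq_transpose_of_trivial]
  have hsn : ‖(Matrix.diagonal s : Matrix (Fin n) (Fin n) ℝ)‖ ≤ 4 := by
    rw [Matrix.l2_opNorm_diagonal, pi_norm_le_iff_of_nonneg (by norm_num)]
    intro i
    rw [Real.norm_eq_abs, abs_of_pos (div_pos (hsP i) (hsA i)), div_le_iff₀ (hsA i)]
    refine Real.sqrt_le_iff.2 ⟨by positivity, ?_⟩
    rw [mul_pow, Real.sq_sqrt (hA i).le]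
    linarith [hdA i]
  have han : ‖(Matrix.diagonal a : Matrix (Fin n) (Fin n) ℝ)‖ ≤ √(16 / δ) := by
    rw [Matrix.l2_opNorm_diagonal, pi_norm_le_iff_of_nonneg (Real.sqrt_nonneg _)]
    intro i
    rw [Real.norm_eq_abs, abs_of_pos (inv_pos.2 (hsA i)), ← Real.sqrt_inv]
    refine Real.sqrt_le_sqrt ?_
    rw [inv_eq_one_div, div_le_div_iff₀ (hA i) hδ]
    linarith [hdA i, hdP i]
  have hn1 : ‖Matrix.diagonal a * (A - P) * Matrix.diagonal a‖ ≤ 16 / δ * ‖A - P‖ := by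
    calc _ ≤ ‖(Matrix.diagonal a : Matrix (Fin n) (Fin n) ℝ)‖ * ‖A - P‖ *
          ‖(Matrix.diagonal a : Matrix (Fin n) (Fin n) ℝ)‖ :=
          (Matrix.l2_opNorm_mul _ _).trans
            (mul_le_mul_of_nonneg_right (Matrix.l2_opNorm_mul _ _) (norm_nonneg _))
      _ ≤ √(16 / δ) * ‖A - P‖ * √(16 / δ) := by gcongr
      _ = √(16 / δ) * √(16 / δ) * ‖A - P‖ := by ring
      _ = _ := by rw [Real.mul_self_sqrt (by positivity)]
  have hn2 : ‖E * Matrix.diagonal s‖ ≤ ‖E‖ * 4 :=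
    (Matrix.l2_opNorm_mul _ _).trans (mul_le_mul_of_nonneg_left hsn (norm_nonneg _))
  rw [hdecomp]
  have t1 := norm_add_le (Matrix.diagonal a * (A - P) * Matrix.diagonal a)
    (E * Matrix.diagonal s + E.transpose)
  have t2 := norm_add_le (E * Matrix.diagonal s) E.transpose
  have : 20 / δ * √(α / δ * ∑ i, (rowDegree A i - rowDegree P i) ^ 2)
      = 5 * (4 / δ * √(α / δ * ∑ i, (rowDegree A i - rowDegree P i) ^ 2)) := by ring
  rw [this]
  linarith

end Laplacian

/-! ### Concentration of the normalized Laplacian. -/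

section Laplacian

variable {Ω : Type*} [MeasurableSpace Ω] {μ : Measure Ω} [IsProbabilityMeasure μ] {n t : ℕ}
  {a : Fin (t + 1) → Ω → Matrix (Fin n) (Fin n) ℝ} {p : Fin (t + 1) → Fin n → Fin n → ℝ}

/-- Concentration of the normalized Laplacian when the logarithm of the size is at most the least
expected degree in units of the largest weight. -/
theorem IsSymmBernoulli.normalizedLaplacian_concentration (h : IsSymmBernoulli μ a p) (hn : 0 < n)
    {β : Fin (t + 1) → ℝ} {b α nmin nmax c : ℝ} (hβ : ∀ k, 0 ≤ β k) (hsum : ∑ k, β k = 1)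
    (hβb : ∀ k, β k ≤ b) (hb : 0 < b) (hα : 0 < α) (hp : ∀ k i j, i ≠ j → p k i j ≤ α)
    (hnmin : 0 < nmin) (hminmax : nmin ≤ nmax) (hnminn : nmin ≤ n)
    (hrow : ∀ i, α * nmin ≤ rowDegree (expectedMatrix μ (smoothedMatrix β a)) i ∧
          rowDegree (expectedMatrix μ (smoothedMatrix β a)) i ≤ α * nmax)
    (hlog : Real.log n ≤ α * nmin / b) (hc : 24 ≤ c) :
    μ.real {ω | (∃ i, rowDegree (smoothedMatrix β a ω) i = 0) ∨
            40000000 * (1 + c) * (nmax / nmin) / nmin * √(n * b / α) ≤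
              matrixSpectralNorm (normalizedLaplacian (smoothedMatrix β a ω) -
                normalizedLaplacian (expectedMatrix μ (smoothedMatrix β a)))} ≤
      n * Real.exp (-(3 / 8 * (α * nmin / b))) +
        4 * Real.exp ((3 - 5 * c / 2) * Real.log n) := by
  have hn' : (0 : ℝ) < n := by exact_mod_cast hn
  set P := expectedMatrix μ (smoothedMatrix β a) with hP
  have hdom := h.poissonDominated hβ hb hβb
  rw [← hP] at hdom
  have hP0 : ∀ i j, 0 ≤ P i j := h.expectedMatrix_nonneg hβ
  have hPα : ∀ i j, P i j ≤ α := h.expectedMatrix_le hβ hsum hα.le hp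
  have hPsymm : ∀ i j, P j i = P i j := h.expectedMatrix_symm β
  have hA0 : ∀ ω i j, 0 ≤ smoothedMatrix β a ω i j := h.smoothedMatrix_nonneg hβ
  have hPrown : ∀ i, rowDegree P i ≤ α * n := by
    intro i
    calc rowDegree P i ≤ ∑ _j : Fin n, α := Finset.sum_le_sum fun j _ => hPα i j
      _ = α * n := by simp [mul_comm]
  have hX : ∀ ω i, ∑ j, (b⁻¹ • smoothedMatrix β a ω) i j =
      b⁻¹ * rowDegree (smoothedMatrix β a ω) i := by
    intro ω i
    simp only [Matrix.smul_apply, smul_eq_mul, rowDegree, Finset.mul_sum]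
  have hm : ∀ i, ∑ j, (b⁻¹ • P) i j = b⁻¹ * rowDegree P i := by
    intro i
    simp only [Matrix.smul_apply, smul_eq_mul, rowDegree, Finset.mul_sum]
  have hXm : ∀ ω i, ∑ j, ((b⁻¹ • smoothedMatrix β a ω) i j - (b⁻¹ • P) i j) =
      b⁻¹ * (rowDegree (smoothedMatrix β a ω) i - rowDegree P i) := by
    intro ω i
    rw [Finset.sum_sub_distrib, hX, hm, mul_sub]
  set q := √(n * α / b) with hq
  have hq0 : 0 < q := Real.sqrt_pos.2 (by positivity)
  have hq2 : q ^ 2 = n * α / b := Real.sq_sqrt (by positivity)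
  -- The given `nmax` may exceed `n`, while concentration asks for `M ≤ q²`; since entries of `P`
  -- are at most `α`, the minimum still bounds the row sums.
  set M := min (α * nmax / b) (q ^ 2) with hM
  have hDM : α * nmin / b ≤ M := by
    refine le_min (by gcongr) ?_
    rw [hq2, mul_comm (n : ℝ)]
    gcongr
  have hM0 : 0 < M := lt_of_lt_of_le (by positivity) hDM
  have hm0 : ∀ i j, 0 ≤ (b⁻¹ • P) i j := fun i j => by
    simpa using mul_nonneg (inv_pos.2 hb).le (hP0 i j)
  have hlow := hdom.tail_row_lower (D := α * nmin / b) (by positivity) fun i => by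
    rw [hm, div_eq_inv_mul]
    exact mul_le_mul_of_nonneg_left (hrow i).1 (inv_pos.2 hb).le
  -- `κ = 5c` is at least `120`, hence above the required `112`.
  have hconc := hdom.concentration (q := q) (M := M) (κ := 5 * c) hn
    (fun ω i j => by simpa using mul_nonneg (inv_pos.2 hb).le (hA0 ω i j))
    (fun ω i j => by simp [h.smoothedMatrix_symm β ω i j]) hm0 hq0
    (fun i j => by
      rw [hq2, Matrix.smul_apply, smul_eq_mul,
        show n * α / b / n = b⁻¹ * α by field_simp]
      exact mul_le_mul_of_nonneg_left (hPα i j) (inv_pos.2 hb).le)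
    hM0 (fun i => by
      rw [hm, hM, hq2, ← div_eq_inv_mul]
      refine le_min ?_ ?_
      · exact div_le_div_of_nonneg_right (hrow i).2 hb.le
      · rw [mul_comm (n : ℝ)]
        exact div_le_div_of_nonneg_right (hPrown i) hb.le)
    (min_le_right _ _) (hlog.trans hDM) (by linarith)
  refine le_trans (le_trans (measureReal_mono ?_ (measure_ne_top _ _))
    (measureReal_union_le _ _)) (add_le_add hlow hconc)
  intro ω hω
  by_contra hnot
  simp only [Set.mem_union, Set.mem_ofPred_eq, not_or, not_not, not_exists, not_le] at hnot hω
  obtain ⟨hdeg, hnorm, hrows⟩ := hnot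
  set A := smoothedMatrix β a ω with hA
  have hdeg' : ∀ i, rowDegree P i / 16 < rowDegree A i := by
    intro i
    have := hdeg i
    rw [hX, hm, mul_div_assoc] at this
    exact lt_of_mul_lt_mul_left this (inv_pos.2 hb).le
  have hδ : 0 < α * nmin := by positivity
  rcases hω with ⟨i, hi⟩ | hω
  · linarith [hdeg' i, (hrow i).1]
  have hlap := matrixSpectralNorm_normalizedLaplacian_sub_le (A := A) hP0 hPα hPsymm hδ
    (fun i => (hrow i).1) fun i => (hdeg' i).le
  set r := √(n * b / α) with hr
  have hr0 : 0 < r := Real.sqrt_pos.2 (by positivity)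
  have hr2 : r ^ 2 = n * b / α := Real.sq_sqrt (by positivity)
  -- Converts the scale of `X` back to that of `A`: `bq = √(nαb)` is `α` times the root in the
  -- statement.
  have hbq : b * q = α * r := by
    refine (sq_eq_sq₀ (by positivity) (by positivity)).1 ?_
    rw [mul_pow, mul_pow, hq2, hr2]; field_simp
  have hAP : matrixSpectralNorm (A - P) ≤ 2000000 * c * (α * r) := by
    have e : A - P = b • (b⁻¹ • A - b⁻¹ • P) := by
      rw [smul_sub, smul_smul, smul_smul, mul_inv_cancel₀ hb.ne', one_smul, one_smul]
    rw [e, matrixSpectralNorm, map_smul, norm_smul, Real.norm_eq_abs, abs_of_pos hb, ← hbq]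
    have := mul_le_mul_of_nonneg_left hnorm hb.le
    rw [matrixSpectralNorm] at this
    linarith
  have hμ1 : 1 ≤ nmax / nmin := (one_le_div hnmin).2 hminmax
  have hG : α / (α * nmin) * ∑ i, (rowDegree A i - rowDegree P i) ^ 2 ≤
      (40 * c * (nmax / nmin) * (α * r)) ^ 2 := by
    have e1 : ∑ i, (rowDegree A i - rowDegree P i) ^ 2 ≤ b ^ 2 * (64 * (5 * c) ^ 2 * (n * M)) := by
      refine le_trans (le_of_eq ?_) (mul_le_mul_of_nonneg_left hrows (by positivity))
      rw [Finset.mul_sum]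
      refine Finset.sum_congr rfl fun i _ => ?_
      rw [hXm, mul_pow, ← hA]
      field_simp
    have e2 : b ^ 2 * (64 * (5 * c) ^ 2 * (n * M)) ≤
        b ^ 2 * (64 * (5 * c) ^ 2 * (n * (α * nmax / b))) := by
      have := min_le_left (α * nmax / b) (q ^ 2)
      gcongr
    calc α / (α * nmin) * ∑ i, (rowDegree A i - rowDegree P i) ^ 2
        ≤ α / (α * nmin) * (b ^ 2 * (64 * (5 * c) ^ 2 * (n * (α * nmax / b)))) :=
          mul_le_mul_of_nonneg_left (e1.trans e2) (by positivity)
      _ = 1600 * c ^ 2 * (nmax / nmin) * (α ^ 2 * (n * b / α)) := by field_simp; ring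
      _ ≤ 1600 * c ^ 2 * (nmax / nmin) ^ 2 * (α ^ 2 * (n * b / α)) := by
          have : nmax / nmin ≤ (nmax / nmin) ^ 2 := by nlinarith
          gcongr
      _ = _ := by rw [← hr2]; ring
  have hG2 : √(α / (α * nmin) * ∑ i, (rowDegree A i - rowDegree P i) ^ 2) ≤
      40 * c * (nmax / nmin) * (α * r) := Real.sqrt_le_iff.2 ⟨by positivity, hG⟩
  have hfin : matrixSpectralNorm (normalizedLaplacian A - normalizedLaplacian P) ≤
      32000800 * c * (nmax / nmin) / nmin * r := by
    refine hlap.trans ?_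
    calc _ ≤ 16 / (α * nmin) * (2000000 * c * (α * r)) +
          20 / (α * nmin) * (40 * c * (nmax / nmin) * (α * r)) := by gcongr
      _ = 32000000 * c / nmin * r * 1 + 800 * c * (nmax / nmin) / nmin * r := by field_simp; ring
      _ ≤ 32000000 * c / nmin * r * (nmax / nmin) + 800 * c * (nmax / nmin) / nmin * r := by gcongr
      _ = _ := by ring
  have hlt : 32000800 * c * (nmax / nmin) / nmin * r <
      40000000 * (1 + c) * (nmax / nmin) / nmin * r := by
    have : 0 < nmax / nmin / nmin * r := by positivity
    have h2 : (32000800 * c) * (nmax / nmin / nmin * r) <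
        (40000000 * (1 + c)) * (nmax / nmin / nmin * r) :=
      mul_lt_mul_of_pos_right (by linarith) this
    calc _ = (32000800 * c) * (nmax / nmin / nmin * r) := by ring
      _ < _ := h2
      _ = _ := by ring
  linarith

end Laplacian

/-! ### The main theorem: trivial regimes and comparison of the error terms. -/

theorem theorem4 :
    ∃ C : ℝ, 0 < C ∧
      ∀ (Ω : Type*) [MeasurableSpace Ω] (μ : Measure Ω) [IsProbabilityMeasure μ] (n t : ℕ)
        (a : Fin (t + 1) → Ω → Matrix (Fin n) (Fin n) ℝ)
        (p : Fin (t + 1) → Fin n → Fin n → ℝ)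
        (β : Fin (t + 1) → ℝ) (βmax Cβ α nmin nmax c : ℝ),
        IsSymmBernoulli μ a p →
        (∀ k, 0 ≤ β k) → ∑ k, β k = 1 → (∀ k, β k ≤ βmax) → ∑ k, β k ^ 2 ≤ Cβ * βmax →
        0 < α → (∀ k i j, i ≠ j → p k i j ≤ α) →
        0 < nmin →
        (∀ i, α * nmin ≤ rowDegree (expectedMatrix μ (smoothedMatrix β a)) i ∧
          rowDegree (expectedMatrix μ (smoothedMatrix β a)) i ≤ α * nmax) →
        0 < c →
        μ.real {ω | (∃ i, rowDegree (smoothedMatrix β a ω) i = 0) ∨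
            C * (1 + c) * (nmax / nmin) / nmin * √(n * βmax / α) ≤
              matrixSpectralNorm (normalizedLaplacian (smoothedMatrix β a ω) -
                normalizedLaplacian (expectedMatrix μ (smoothedMatrix β a)))} ≤
          Real.exp (-((c ^ 2 / 2) / (2 * Cβ + 2 / 3 * c) - Real.log 14) * n) +
          Real.exp (-((c ^ 2 / 2) / (Cβ + 2 * c / 3)) * (n * α / βmax) + Real.log n) +
          Real.exp (-((1 / 8) / (Cβ + 1 / 3)) * (nmin * α / ((nmax / nmin) * βmax)) +
            Real.log n) +
          (n : ℝ) ^ (-c / 4 + 6) := by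
  refine ⟨40000000, by norm_num, ?_⟩
  intro Ω _ μ _ n t a p β βmax Cβ α nmin nmax c h hβ hsum hβb hCβ hα hp hnmin hrow hc
  set T1 := Real.exp (-((c ^ 2 / 2) / (2 * Cβ + 2 / 3 * c) - Real.log 14) * n) with hT1
  set T2 := Real.exp (-((c ^ 2 / 2) / (Cβ + 2 * c / 3)) * (n * α / βmax) + Real.log n)
  set T3 := Real.exp (-((1 / 8) / (Cβ + 1 / 3)) * (nmin * α / ((nmax / nmin) * βmax)) +
            Real.log n) with hT3
  set T4 := (n : ℝ) ^ (-c / 4 + 6) with hT4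
  have p1 : 0 < T1 := Real.exp_pos _
  have p2 : 0 < T2 := Real.exp_pos _
  have p3 : 0 < T3 := Real.exp_pos _
  have p4 : 0 ≤ T4 := Real.rpow_nonneg n.cast_nonneg _
  rcases Nat.eq_zero_or_pos n with hn0 | hn
  · have : T1 = 1 := by rw [hT1, hn0]; simp
    exact measureReal_le_one.trans (by linarith)
  have hn' : (0 : ℝ) < n := by exact_mod_cast hn
  have hn1 : (1 : ℝ) ≤ n := by exact_mod_cast hn
  -- For `c ≤ 24` the exponent `-c/4 + 6` is nonnegative and the fourth term is at least `1`.
  by_cases hc24 : c ≤ 24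
  · have : 1 ≤ T4 := Real.one_le_rpow hn1 (by linarith)
    exact measureReal_le_one.trans (by linarith)
  push Not at hc24
  -- If the third term is below `1`, then `log n` is less than its rate, which `hD` bounds by `3/8`
  -- of the least expected degree of `X`: this supplies the assumption on `log n`.
  by_cases hT31 : 1 ≤ T3
  · exact measureReal_le_one.trans (by linarith)
  rw [hT3, Real.one_le_exp_iff, not_le] at hT31
  have i0 : Fin n := ⟨0, hn⟩
  have hminmax : nmin ≤ nmax :=
    le_of_mul_le_mul_left ((hrow i0).1.trans (hrow i0).2) hα
  have hPα := h.expectedMatrix_le hβ hsum hα.le hp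
  have hnminn : nmin ≤ n := by
    refine le_of_mul_le_mul_left ((hrow i0).1.trans ?_) hα
    calc rowDegree (expectedMatrix μ (smoothedMatrix β a)) i0 ≤ ∑ _j : Fin n, α :=
          Finset.sum_le_sum fun j _ => hPα i0 j
      _ = α * n := by simp [mul_comm]
  -- With one vertex the zero diagonal makes the expected degree zero, against its lower bound.
  -- Having `n ≥ 2` lets the factor `4` be absorbed into `n²` below.
  have hn2 : (2 : ℝ) ≤ n := by
    suffices 2 ≤ n by exact_mod_cast this
    by_contra hlt
    obtain rfl : n = 1 := by omega
    have h1 := (hrow i0).1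
    have h2 : rowDegree (expectedMatrix μ (smoothedMatrix β a)) i0 = 0 := by
      rw [rowDegree, Finset.sum_eq_zero]
      intro j _
      rw [Subsingleton.elim j i0, h.expectedMatrix_diag]
    have : 0 < α * nmin := by positivity
    linarith
  have hb : 0 < βmax := by
    by_contra hneg
    have : ∑ k, β k ≤ ∑ _k : Fin (t + 1), (0 : ℝ) :=
      Finset.sum_le_sum fun k _ => (hβb k).trans (not_lt.1 hneg)
    rw [hsum, Finset.sum_const_zero] at this
    linarith
  have hCβ0 : 0 ≤ Cβ := by
    have : 0 ≤ Cβ * βmax := (Finset.sum_nonneg fun k _ => sq_nonneg _).trans hCβ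
    exact nonneg_of_mul_nonneg_left this hb
  have hμ1 : 1 ≤ nmax / nmin := (one_le_div hnmin).2 hminmax
  have hD : (1 / 8) / (Cβ + 1 / 3) * (nmin * α / ((nmax / nmin) * βmax)) ≤
      3 / 8 * (α * nmin / βmax) := by
    have e1 : (1 / 8) / (Cβ + 1 / 3) ≤ 3 / 8 := by
      rw [div_le_iff₀ (by linarith)]; linarith
    have e2 : nmin * α / ((nmax / nmin) * βmax) ≤ α * nmin / βmax := by
      rw [mul_comm nmin]
      exact div_le_div_of_nonneg_left (by positivity) hb (by nlinarith)
    exact mul_le_mul e1 e2 (by positivity) (by norm_num)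
  have hD0 : 0 < α * nmin / βmax := by positivity
  refine (h.normalizedLaplacian_concentration hn hβ hsum hβb hb hα hp hnmin hminmax hnminn hrow
    (by linarith) hc24.le).trans ?_
  have b3 : n * Real.exp (-(3 / 8 * (α * nmin / βmax))) ≤ T3 := by
    calc n * Real.exp (-(3 / 8 * (α * nmin / βmax)))
        = Real.exp (Real.log n + -(3 / 8 * (α * nmin / βmax))) := by
          rw [Real.exp_add, Real.exp_log hn']
      _ ≤ T3 := Real.exp_le_exp.2 (by linarith)
  have b4 : 4 * Real.exp ((3 - 5 * c / 2) * Real.log n) ≤ T4 := by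
    have hl : 0 ≤ Real.log n := Real.log_natCast_nonneg n
    rw [hT4, Real.rpow_def_of_pos hn']
    have e4 : (4 : ℝ) ≤ Real.exp (2 * Real.log n) := by
      rw [two_mul, Real.exp_add, Real.exp_log hn']; nlinarith
    calc 4 * Real.exp ((3 - 5 * c / 2) * Real.log n)
        ≤ Real.exp (2 * Real.log n) * Real.exp ((3 - 5 * c / 2) * Real.log n) := by gcongr
      _ = Real.exp (Real.log n * (5 - 5 * c / 2)) := by rw [← Real.exp_add]; congr 1; ring
      _ ≤ _ := Real.exp_le_exp.2 (mul_le_mul_of_nonneg_left (by linarith) hl)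
  linarith
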